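/- Let $V$ be a finite-dimensional real Euclidean space with inner product $(\cdot,\cdot)$, $R\subset V$ a reduced (crystallographic) root system spanning $V$ (the root system of a semisimple Lie algebra), $W$ its Weyl group, generated by the orthogonal reflections $s_\alpha$, $\alpha\in R$, and $\alpha^\vee=2\alpha/(\alpha,\alpha)$. Let $R_+=\{\alpha\in R:\ell(\alpha)>0\}$ be the positive part of $R$ with respect to a linear form $\ell$ on $V$ vanishing at no root. Extend $(\cdot,\cdot)$ bilinearly, and the action of $W$ linearly, to $V_{\mathbf C}=V\otimes_{\mathbf R}\mathbf C$. Fix $\tau\in\mathbf C$ with $\operatorname{Im}\tau>0$, put $\Lambda=\mathbf Z+\tau\mathbf Z$ and $$\theta_1(z)=-\sum_{n\in\mathbf Z}e^{2\pi i(z+\frac12)(n+\frac12)+\pi i\tau(n+\frac12)^2},\qquad \sigma_\mu(z)=\frac{\theta_1(z-\mu)\,\theta_1'(0)}{\theta_1(z)\,\theta_1(-\mu)}\quad(\mu\in\mathbf C\setminus\Lambda).$$ Let $k:R\to\mathbf C$, $\alpha\mapsto k_\alpha$, be $W$-invariant, and let $\lambda\in V_{\mathbf C}$ be generic, i.e.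 $(\alpha^\vee,\lambda)\notin\Lambda$ for all $\alpha\in R$. Call a point $x$ of $V$ or of $V_{\mathbf C}$ regular if $(\alpha,x)\notin\Lambda$ for all $\alpha\in R$. (a) The functions $f_\alpha(z)=k_\alpha\,\sigma_{(\alpha^\vee,\lambda)}(z)$ satisfy the functional equations $$\sum_{\alpha,\beta\in R_+:\ s_\alpha s_\beta=r}\langle\alpha,\beta\rangle\, f_\alpha((\alpha,x))\,f_\beta((s_\alpha(\beta),x))=0$$ for every rotation $r$ and all regular $x\in V_{\mathbf C}$. Here $\langle\alpha,\beta\rangle$ is the oriented area of the parallelogram with sides $\alpha,\beta$, with respect to either orientation of a plane that contains all the roots $\alpha,\beta$ occurring in the sum. (b) Let $(\hat s_\alpha g)(x)=g(s_\alpha(x))$, let $\partial_\xi$ be the derivative in direction $\xi$, and let $$\nabla^\lambda_\xi=\partial_\xi+\sum_{\alpha\in R_+}k_\alpha\,(\alpha,\xi)\,\sigma_{(\alpha^\vee,\lambda)}((\alpha,x))\,\hat s_\alpha$$ be the elliptic Dunkl operators. They commute, $$\nabla^\lambda_\xi\nabla^\lambda_\eta=\nabla^\lambda_\eta\nabla^\lambda_\xi,$$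 for all $\xi,\eta\in V$ on $C^2$ functions $g:U\to\mathbf C$, where $U$ is any $W$-stable open set of regular points of $V$, and for all $\xi,\eta\in V_{\mathbf C}$ on holomorphic functions on $U$, where $U$ is any $W$-stable open set of regular points of $V_{\mathbf C}$. (c) They are $W$-equivariant: with $(\hat w g)(x)=g(w^{-1}(x))$, $$\hat w\,\nabla^\lambda_\xi\,\hat w^{-1}=\nabla^{w(\lambda)}_{w(\xi)}\qquad(w\in W)$$ for $\xi\in V$ on differentiable functions on $U$ in the first case, and for $\xi\in V_{\mathbf C}$ on holomorphic functions on $U$ in the second. -/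

import Mathlib

open scoped TensorProduct InnerProductSpace

noncomputable section

namespace EllipticDunkl

/-! ### Jacobi's theta function and the functions `σ_μ` -/

/-- The lattice `ℤ + τ ℤ`. -/
def periodLattice (τ : ℂ) : Set ℂ := {z | ∃ m n : ℤ, z = m + n * τ}

/-- Jacobi's theta function `θ₁`. -/
def theta1 (τ z : ℂ) : ℂ :=
  -∑' n : ℤ, Complex.exp (2 * Real.pi * Complex.I * (z + 1 / 2) * ((n : ℂ) + 1 / 2)
    + Real.pi * Complex.I * τ * ((n : ℂ) + 1 / 2) ^ 2)

/-- `σ_μ(z) = θ₁(z - μ) θ₁'(0) / (θ₁(z) θ₁(-μ))`. -/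
def ellSigma (τ μ z : ℂ) : ℂ :=
  theta1 τ (z - μ) * deriv (theta1 τ) 0 / (theta1 τ z * theta1 τ (-μ))

/-! ### Root systems in a Euclidean space -/

section Roots

variable {V : Type*} [NormedAddCommGroup V] [InnerProductSpace ℝ V]

/-- The orthogonal reflection `s_α` of `V` in the hyperplane `α^⊥`. -/
def refl (α : V) : V ≃ₗᵢ[ℝ] V := (ℝ ∙ α)ᗮ.reflection

/-- The coroot `α^∨ = 2 α / (α, α)`. -/
def coroot (α : V) : V := (2 / ⟪α, α⟫_ℝ) • α

/-- A reduced (crystallographic) root system in the Euclidean space `V`, that is, the root system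
of a semisimple complex Lie algebra. -/
structure IsReducedRootSystem (R : Finset V) : Prop where
  span_eq_top : Submodule.span ℝ (R : Set V) = ⊤
  zero_notMem : (0 : V) ∉ R
  refl_mem : ∀ α ∈ R, ∀ β ∈ R, refl α β ∈ R
  integral : ∀ α ∈ R, ∀ β ∈ R, ∃ n : ℤ, ⟪coroot α, β⟫_ℝ = n
  reduced : ∀ α ∈ R, ∀ c : ℝ, c • α ∈ R → c = 1 ∨ c = -1

/-- The Weyl group, generated by the reflections in the roots. -/
def weylGroup (R : Finset V) : Subgroup (V ≃ₗᵢ[ℝ] V) :=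
  Subgroup.closure {w | ∃ α ∈ R, w = refl α}

open scoped Classical in
/-- The positive part `R₊` of `R` with respect to the linear form `ℓ`. -/
def posRoots (R : Finset V) (ℓ : V →ₗ[ℝ] ℝ) : Finset V := R.filter fun α => 0 < ℓ α

/-! ### The complexification `V_ℂ = ℂ ⊗ V` -/

/-- `(α, x)` for `α ∈ V` and `x ∈ V_ℂ`: the `ℂ`-linear extension of the inner product. -/
def pairC (α : V) : (ℂ ⊗[ℝ] V) →ₗ[ℂ] ℂ :=
  LinearMap.BilinForm.baseChange ℂ (innerₗ V) (1 ⊗ₜ[ℝ] α)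

theorem pairC_tmul (α : V) (z : ℂ) (v : V) :
    pairC α (z ⊗ₜ[ℝ] v) = z * (⟪α, v⟫_ℝ : ℂ) := by
  simp [pairC, mul_comm]

/-- The action on `V_ℂ` of a linear isometry of `V`. -/
def complexify (w : V ≃ₗᵢ[ℝ] V) : (ℂ ⊗[ℝ] V) →ₗ[ℂ] (ℂ ⊗[ℝ] V) :=
  LinearMap.baseChange ℂ (w.toLinearEquiv : V →ₗ[ℝ] V)

theorem complexify_tmul (w : V ≃ₗᵢ[ℝ] V) (z : ℂ) (v : V) :
    complexify w (z ⊗ₜ[ℝ] v) = z ⊗ₜ[ℝ] w v := by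
  simp [complexify]

/-- A subset of `V_ℂ` is open if it is open in linear coordinates. -/
def IsOpenC (U : Set (ℂ ⊗[ℝ] V)) : Prop :=
  ∀ (n : ℕ) (e : (Fin n → ℂ) ≃ₗ[ℂ] (ℂ ⊗[ℝ] V)), IsOpen (e ⁻¹' U)

/-- A function on an open subset `U` of `V_ℂ` is holomorphic if it is so in linear coordinates. -/
def IsHolomorphicOn (g : (ℂ ⊗[ℝ] V) → ℂ) (U : Set (ℂ ⊗[ℝ] V)) : Prop :=
  ∀ (n : ℕ) (e : (Fin n → ℂ) ≃ₗ[ℂ] (ℂ ⊗[ℝ] V)), DifferentiableOn ℂ (g ∘ e) (e ⁻¹' U)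

/-- `μ ∈ V_ℂ` is generic if `(α^∨, μ) ∉ ℤ + τ ℤ` for all roots `α`. -/
def IsGeneric (R : Finset V) (τ : ℂ) (μ : ℂ ⊗[ℝ] V) : Prop :=
  ∀ α ∈ R, pairC (coroot α) μ ∉ periodLattice τ

/-- The points `x` of `V` with `(α, x) ∉ ℤ + τ ℤ` for all roots `α`. -/
def regularSet (R : Finset V) (τ : ℂ) : Set V :=
  {x | ∀ α ∈ R, (⟪α, x⟫_ℝ : ℂ) ∉ periodLattice τ}

/-- The points `x` of `V_ℂ` with `(α, x) ∉ ℤ + τ ℤ` for all roots `α`. -/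
def regularSetC (R : Finset V) (τ : ℂ) : Set (ℂ ⊗[ℝ] V) :=
  {x | ∀ α ∈ R, pairC α x ∉ periodLattice τ}

/-! ### The functional equations -/

/-- The oriented area of the parallelogram with sides `α`, `β`, for `α` and `β` in the plane `E`
with orientation `o` (the projection onto `E` only serves to regard `α` and `β` as vectors
of `E`). -/
def orientedArea [FiniteDimensional ℝ V] (E : Submodule ℝ V) [Fact (Module.finrank ℝ E = 2)]
    (o : Orientation ℝ E (Fin 2)) (α β : V) : ℝ :=
  o.areaForm (E.orthogonalProjectionOnto α) (E.orthogonalProjectionOnto β)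

open scoped Classical in
/-- The functional equations for a family of functions `f_α`, at all points `x` of `U ⊆ V_ℂ`: for
every `r` and every oriented plane `E` containing the roots `α`, `β ∈ R₊` with `s_α s_β = r`,
`∑_{α, β ∈ R₊, s_α s_β = r} ⟨α, β⟩ f_α((α, x)) f_β((s_α(β), x)) = 0`. -/
def FunctionalEquations [FiniteDimensional ℝ V] (Rpos : Finset V) (f : V → ℂ → ℂ)
    (U : Set (ℂ ⊗[ℝ] V)) : Prop :=
  ∀ (r : V ≃ₗᵢ[ℝ] V) (E : Submodule ℝ V) [Fact (Module.finrank ℝ E = 2)]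
    (o : Orientation ℝ E (Fin 2)),
    (∀ α ∈ Rpos, ∀ β ∈ Rpos, refl α * refl β = r → α ∈ E ∧ β ∈ E) →
    ∀ x ∈ U,
      ∑ p ∈ (Rpos ×ˢ Rpos).filter (fun p => refl p.1 * refl p.2 = r),
        (orientedArea E o p.1 p.2 : ℂ) * f p.1 (pairC p.1 x) * f p.2 (pairC (refl p.1 p.2) x) = 0

/-! ### Operators of Dunkl type -/

/-- `∇_ξ = ∂_ξ + ∑_{α ∈ R₊} (α, ξ) f_α((α, x)) ŝ_α` on functions on `V`,
with `(ŝ_α g)(x) = g(s_α(x))`. -/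
def dunkl (Rpos : Finset V) (f : V → ℂ → ℂ) (ξ : V) (g : V → ℂ) : V → ℂ := fun x =>
  lineDeriv ℝ g x ξ + ∑ α ∈ Rpos, (⟪α, ξ⟫_ℝ : ℂ) * f α (⟪α, x⟫_ℝ : ℂ) * g (refl α x)

/-- The same operators on functions on `V_ℂ`, for `ξ ∈ V_ℂ`. -/
def dunklC (Rpos : Finset V) (f : V → ℂ → ℂ) (ξ : ℂ ⊗[ℝ] V) (g : (ℂ ⊗[ℝ] V) → ℂ) :
    (ℂ ⊗[ℝ] V) → ℂ := fun x =>
  lineDeriv ℂ g x ξ + ∑ α ∈ Rpos, pairC α ξ * f α (pairC α x) * g (complexify (refl α) x)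

/-- The functions `f_α(z) = k_α σ_{(α^∨, μ)}(z)`. -/
def ellFun (τ : ℂ) (k : V → ℂ) (μ : ℂ ⊗[ℝ] V) (α : V) (z : ℂ) : ℂ :=
  k α * ellSigma τ (pairC (coroot α) μ) z

/-- The elliptic Dunkl operators `∇^μ_ξ` on functions on `V`. -/
def ellDunkl (Rpos : Finset V) (τ : ℂ) (k : V → ℂ) (μ : ℂ ⊗[ℝ] V) (ξ : V) :
    (V → ℂ) → V → ℂ :=
  dunkl Rpos (ellFun τ k μ) ξ

/-- The elliptic Dunkl operators `∇^μ_ξ` on functions on `V_ℂ`. -/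
def ellDunklC (Rpos : Finset V) (τ : ℂ) (k : V → ℂ) (μ ξ : ℂ ⊗[ℝ] V) :
    ((ℂ ⊗[ℝ] V) → ℂ) → (ℂ ⊗[ℝ] V) → ℂ :=
  dunklC Rpos (ellFun τ k μ) ξ

/-- `(ŵ g)(x) = g(w⁻¹(x))` on functions on `V`. -/
def hat (w : V ≃ₗᵢ[ℝ] V) (g : V → ℂ) : V → ℂ := fun x => g (w⁻¹ x)

/-- `(ŵ g)(x) = g(w⁻¹(x))` on functions on `V_ℂ`. -/
def hatC (w : V ≃ₗᵢ[ℝ] V) (g : (ℂ ⊗[ℝ] V) → ℂ) : (ℂ ⊗[ℝ] V) → ℂ :=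
  fun x => g (complexify w⁻¹ x)

end Roots

end EllipticDunkl

end

namespace EllipticDunkl

open Complex Filter Topology

/-! ### The period lattice -/

section Lattice

variable {τ : ℂ}

/-! The core is the functional equation summed over all pairs of roots with `s_α s_β = r`, with the
oriented area replaced by an arbitrary alternating form `ω` (`sum_pairTerm_eq_zero`). For `r = 1`
the two roots are proportional and `ω α β = 0`.

For `r ≠ 1`, let `x` move along a line `x + t p₀` with `p₀` a coroot, so that all `(α, p₀)` are
integers. Each term is then meromorphic in `t`, is 1-periodic, and under `t ↦ t + τ` acquires the
factor `exp (2πi (v, λ))` with `v = (α, p₀) α^∨ + (s_α β, p₀) β^∨ = p₀ - r⁻¹ p₀`. This vector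
depends on `r` only (`inner_smul_coroot_add`), so the whole sum is quasi-periodic. The residue
coming from the first factor of the pair `(α, β)` cancels the one coming from the second factor of
`(β, s_β α)` (`sum_residues_eq_zero`), because `ω` changes sign and the factors of automorphy match.
By Liouville (`liouville_quasiperiodic`) the sum is `C exp (2πint)`, and `C ≠ 0` would force `(v, λ)
∈ Λ`. A small perturbation of `λ` and `x` excludes this and keeps the poles simple; continuity then
gives the general case.

The terms are even in `α` and in `β`, since `σ_{-μ}(-z) = -σ_μ(z)`, so the sum over `R` is four
times the sum over `R₊`. The area form gives (a). In the commutator of two Dunkl operators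
everything of positive order cancels, and what remains is the same sum for `ω = ξ ∧ η`, the terms
being weighted by `g (r⁻¹ x)`; this gives (b). For (c), conjugation by `w` permutes the terms of a
sum over all roots, and evenness again passes to `R₊`.

The analytic input, that `θ₁` vanishes only on `Λ` and that `θ₁'(0) ≠ 0`, comes from comparing `θ₁`
with its infinite product by the same Liouville theorem. -/

theorem add_mem_periodLattice {z w : ℂ} (hz : z ∈ periodLattice τ) (hw : w ∈ periodLattice τ) :
    z + w ∈ periodLattice τ := by
  obtain ⟨m, n, rfl⟩ := hz
  obtain ⟨m', n', rfl⟩ := hw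
  exact ⟨m + m', n + n', by push_cast; ring⟩

theorem int_mul_mem_periodLattice (k : ℤ) {z : ℂ} (hz : z ∈ periodLattice τ) :
    k * z ∈ periodLattice τ := by
  obtain ⟨m, n, rfl⟩ := hz
  exact ⟨k * m, k * n, by push_cast; ring⟩

theorem neg_mem_periodLattice {z : ℂ} (hz : z ∈ periodLattice τ) : -z ∈ periodLattice τ := by
  simpa using int_mul_mem_periodLattice (-1) hz

theorem neg_mem_periodLattice_iff {z : ℂ} : -z ∈ periodLattice τ ↔ z ∈ periodLattice τ :=
  ⟨fun h => by simpa using neg_mem_periodLattice h, neg_mem_periodLattice⟩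

theorem sub_mem_periodLattice {z w : ℂ} (hz : z ∈ periodLattice τ) (hw : w ∈ periodLattice τ) :
    z - w ∈ periodLattice τ := by
  simpa [sub_eq_add_neg] using add_mem_periodLattice hz (neg_mem_periodLattice hw)

theorem one_mem_periodLattice : (1 : ℂ) ∈ periodLattice τ := ⟨1, 0, by simp⟩

theorem self_mem_periodLattice : τ ∈ periodLattice τ := ⟨0, 1, by simp⟩

/-- Real coordinates on `ℂ` in which the lattice is `ℤ × ℤ`. -/
noncomputable def latticeCoord (τ z : ℂ) : ℝ × ℝ := (z.re - z.im / τ.im * τ.re, z.im / τ.im)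

theorem latticeCoord_spec (hτ : 0 < τ.im) (z : ℂ) :
    ((latticeCoord τ z).1 : ℂ) + (latticeCoord τ z).2 * τ = z := by
  apply Complex.ext <;> simp [latticeCoord, hτ.ne']

theorem continuous_latticeCoord : Continuous (latticeCoord τ) := by
  unfold latticeCoord
  fun_prop

/-- In the coordinates `latticeCoord`, every subset of the lattice is a subset of `ℤ × ℤ`, hence
closed in the plane. Removing `z` isolates `z` from the remaining lattice points, whether or not `z`
is one itself. -/
theorem isClosed_periodLattice_diff (hτ : 0 < τ.im) (z : ℂ) :
    IsClosed (periodLattice τ \ {z}) := by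
  have hι : IsClosedEmbedding (Prod.map ((↑) : ℤ → ℝ) ((↑) : ℤ → ℝ)) :=
    Int.isClosedEmbedding_coe_real.prodMap Int.isClosedEmbedding_coe_real
  have : periodLattice τ \ {z} = latticeCoord τ ⁻¹'
      (Prod.map ((↑) : ℤ → ℝ) ((↑) : ℤ → ℝ) '' {p | (p.1 : ℂ) + p.2 * τ ≠ z}) := by
    ext w
    constructor
    · rintro ⟨⟨m, n, rfl⟩, h⟩
      refine ⟨(m, n), h, ?_⟩
      simp [latticeCoord, hτ.ne']
    · rintro ⟨⟨m, n⟩, h, h'⟩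
      have : (m : ℂ) + n * τ = w := by
        rw [← latticeCoord_spec hτ w, ← h']
        simp
      rw [← this]
      exact ⟨⟨m, n, rfl⟩, h⟩
  rw [this]
  exact (hι.isClosedMap _ (isClosed_discrete _)).preimage continuous_latticeCoord

theorem eventually_notMem_periodLattice (hτ : 0 < τ.im) (z : ℂ) :
    ∀ᶠ w in 𝓝[≠] z, w ∉ periodLattice τ := by
  have := (isClosed_periodLattice_diff hτ z).isOpen_compl.mem_nhds (x := z) (by simp)
  filter_upwards [mem_nhdsWithin_of_mem_nhds this, self_mem_nhdsWithin] with w hw hw' h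
  exact hw ⟨h, hw'⟩

/-- An affine function of one variable avoids the lattice near, but not at, a given point. -/
theorem eventually_affine_notMem (hτ : 0 < τ.im) (a b : ℂ) (h : b = 0 → a ∉ periodLattice τ)
    (t₀ : ℂ) : ∀ᶠ t in 𝓝[≠] t₀, a + t * b ∉ periodLattice τ := by
  by_cases hb : b = 0
  · simp [hb, h hb]
  · have ht : Tendsto (fun t : ℂ => a + t * b) (𝓝[≠] t₀) (𝓝[≠] (a + t₀ * b)) := by
      apply tendsto_nhdsWithin_of_tendsto_nhds_of_eventually_within
      · exact (Continuous.tendsto (by fun_prop) _).mono_left nhdsWithin_le_nhds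
      · filter_upwards [self_mem_nhdsWithin] with t ht
        simpa [hb] using ht
    exact ht.eventually (eventually_notMem_periodLattice hτ _)

end Lattice

/-! ### A Liouville theorem for quasi-periodic functions -/

/-- The condition `h0` makes all singularities removable. Multiplying by a suitable exponential
makes the modulus doubly periodic, so the product is bounded and therefore constant. Since `f` may
have arbitrary values at removable singularities, the conclusion speaks only of points of
continuity. -/
theorem liouville_quasiperiodic {τ : ℂ} (hτ : 0 < τ.im) {f : ℂ → ℂ} {c : ℂ} (hc : c ≠ 0)
    (hm : ∀ z, MeromorphicAt f z)
    (h0 : ∀ z, Tendsto (fun w => (w - z) * f w) (𝓝[≠] z) (𝓝 0))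
    (h1 : ∀ z, f (z + 1) = f z) (hq : ∀ z, f (z + τ) = c * f z) :
    ∃ (C : ℂ) (n : ℤ), (C ≠ 0 → c = exp (2 * Real.pi * I * n * τ)) ∧
      ∀ z, ContinuousAt f z → f z = C * exp (2 * Real.pi * I * n * z) := by
  set g := toMeromorphicNFOn f Set.univ with hg
  have hmon : MeromorphicOn f Set.univ := fun z _ => hm z
  have hfg : ∀ z, f =ᶠ[𝓝[≠] z] g := fun z =>
    (hmon.toMeromorphicNFOn_eq_self_on_nhdsNE (Set.mem_univ z)).symm
  have han : ∀ z, AnalyticAt ℂ g z := by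
    intro z
    -- The product `(w - z) f(w)` tends to `0`, so its order `1 + ord f` is positive.
    have hord : 0 ≤ meromorphicOrderAt f z := by
      have hid : MeromorphicAt (fun w : ℂ => w - z) z := by fun_prop
      have hpos := (tendsto_zero_iff_meromorphicOrderAt_pos (hid.mul (hm z))).1 (h0 z)
      rw [meromorphicOrderAt_mul hid (hm z)] at hpos
      have h1 : meromorphicOrderAt (fun w : ℂ => w - z) z = 1 := by
        exact (meromorphicOrderAt_eq_int_iff (n := 1) hid).2
          ⟨fun _ => 1, analyticAt_const, one_ne_zero, by simp⟩
      rw [h1] at hpos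
      cases h : meromorphicOrderAt f z with
      | top => exact le_top
      | coe n =>
        rw [h] at hpos
        have : (0 : ℤ) < 1 + n := by exact_mod_cast hpos
        have : (0 : ℤ) ≤ n := by omega
        exact_mod_cast this
    rw [← meromorphicOrderAt_toMeromorphicNFOn hmon (Set.mem_univ z)] at hord
    exact (meromorphicNFOn_toMeromorphicNFOn f Set.univ
      (Set.mem_univ z)).meromorphicOrderAt_nonneg_iff_analyticAt.1 hord
  have hcont : ∀ z, ContinuousAt f z → f z = g z := fun z hz =>
    tendsto_nhds_unique_of_eventuallyEq (hz.tendsto.mono_left nhdsWithin_le_nhds)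
      ((han z).continuousAt.tendsto.mono_left nhdsWithin_le_nhds) (hfg z)
  have hshift : ∀ (a d : ℂ), (∀ z, f (z + a) = d * f z) → ∀ z, g (z + a) = d * g z := by
    intro a d h z
    have ht : Tendsto (fun w : ℂ => w + a) (𝓝[≠] z) (𝓝[≠] (z + a)) := by
      apply tendsto_nhdsWithin_of_tendsto_nhds_of_eventually_within
      · exact (Continuous.tendsto (by fun_prop) _).mono_left nhdsWithin_le_nhds
      · filter_upwards [self_mem_nhdsWithin] with t ht
        simpa using ht
    refine tendsto_nhds_unique_of_eventuallyEq
      (((han (z + a)).continuousAt.tendsto.mono_left nhdsWithin_le_nhds).comp ht)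
      (((han z).continuousAt.tendsto.mono_left nhdsWithin_le_nhds).const_mul d) ?_
    filter_upwards [ht.eventually (hfg (z + a)), hfg z] with w hw hw'
    rw [Function.comp_apply, ← hw, h, hw']
  have hg1 : ∀ z, g (z + 1) = g z := by simpa using hshift 1 1 (by simpa using h1)
  have hgτ := hshift τ c hq
  clear_value g
  -- As `s` is real, `exp (2πis)` has modulus 1. Its value is chosen so that `|exp (2πisτ)| = exp
  -- (-2πs Im τ) = |c|⁻¹`, which compensates the factor `c`.
  set s : ℝ := Real.log ‖c‖ / (2 * Real.pi * τ.im) with hs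
  set h : ℂ → ℂ := fun z => g z * exp (2 * Real.pi * I * s * z) with hh
  have hn1 : ∀ z, ‖h (z + 1)‖ = ‖h z‖ := by
    intro z
    simp only [hh, hg1, mul_add, exp_add, norm_mul, Complex.norm_exp]
    simp
  have hnτ : ∀ z, ‖h (z + τ)‖ = ‖h z‖ := by
    intro z
    have : ‖exp (2 * Real.pi * I * s * τ)‖ = ‖c‖⁻¹ := by
      rw [Complex.norm_exp]
      have : (2 * Real.pi * I * s * τ).re = -Real.log ‖c‖ := by
        have : (2 * Real.pi * I * s * τ).re = -(2 * Real.pi * s * τ.im) := by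
          simp
        rw [this, hs]
        field_simp
      rw [this, Real.exp_neg, Real.exp_log (norm_pos_iff.2 hc)]
    simp only [hh, hgτ, mul_add, exp_add, norm_mul, this]
    have := norm_ne_zero_iff.2 hc
    field_simp
  have hnm : ∀ (a : ℂ), (∀ z, ‖h (z + a)‖ = ‖h z‖) → ∀ (m : ℤ) z, ‖h (z + m * a)‖ = ‖h z‖ := by
    intro a ha m
    induction m using Int.induction_on with
    | zero => simp
    | succ i ih =>
      intro z
      rw [← ih z, ← ha (z + ((i : ℤ) : ℂ) * a)]
      push_cast
      ring_nf
    | pred i ih =>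
      intro z
      rw [← ih z, ← ha (z + (-(i : ℤ) - 1 : ℤ) * a)]
      push_cast
      ring_nf
  have hhd : Differentiable ℂ h := fun z =>
    (han z).differentiableAt.mul (by fun_prop)
  obtain ⟨B, hB⟩ : ∃ B, ∀ z, ‖h z‖ ≤ B := by
    have hK : IsCompact ((fun p : ℝ × ℝ => (p.1 : ℂ) + p.2 * τ) ''
        (Set.Icc (0 : ℝ) 1 ×ˢ Set.Icc (0 : ℝ) 1)) :=
      (isCompact_Icc.prod isCompact_Icc).image (by fun_prop)
    obtain ⟨B, hB⟩ := hK.exists_bound_of_continuousOn hhd.continuous.continuousOn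
    refine ⟨B, fun z => ?_⟩
    set p := latticeCoord τ z with hp
    have hz := latticeCoord_spec hτ z
    rw [← hp] at hz
    have := hB ((Int.fract p.1 : ℝ) + (Int.fract p.2 : ℝ) * τ)
      ⟨(Int.fract p.1, Int.fract p.2), ⟨⟨Int.fract_nonneg _, (Int.fract_lt_one _).le⟩,
        ⟨Int.fract_nonneg _, (Int.fract_lt_one _).le⟩⟩, rfl⟩
    rw [← hnm τ hnτ ⌊p.2⌋, ← hnm 1 hn1 ⌊p.1⌋] at this
    convert this using 3
    rw [← hz]
    conv_lhs => rw [← Int.fract_add_floor p.1, ← Int.fract_add_floor p.2]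
    push_cast
    ring
  have hconst : ∀ z, h z = h 0 := fun z =>
    hhd.apply_eq_apply_of_bounded
      (isBounded_iff_forall_norm_le.2 ⟨B, by rintro _ ⟨z, rfl⟩; exact hB z⟩) z 0
  have hgz : ∀ z, g z = h 0 * exp (-(2 * Real.pi * I * s * z)) := by
    intro z
    rw [← hconst z, hh]
    simp [mul_assoc, ← exp_add]
  by_cases hC : h 0 = 0
  · exact ⟨0, 0, by simp, fun z hz => by rw [hcont z hz, hgz, hC]; simp⟩
  -- Genuine 1-periodicity of `g`, not only of its modulus, forces `s` to be an integer.
  have hs1 : exp (-(2 * Real.pi * I * s)) = 1 := by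
    have h2 := hg1 0
    rw [hgz, hgz] at h2
    simpa [hC] using h2
  obtain ⟨n, hn⟩ := Complex.exp_eq_one_iff.1 hs1
  have hsn : (s : ℂ) = -n := by
    have h2 : (2 * Real.pi * I : ℂ) ≠ 0 := Complex.two_pi_I_ne_zero
    have : (2 * Real.pi * I : ℂ) * (s + n) = 0 := by linear_combination -hn
    rcases mul_eq_zero.1 this with h | h
    · exact absurd h h2
    · linear_combination h
  refine ⟨h 0, n, fun _ => ?_, fun z hz => ?_⟩
  · have h2 := hgτ 0
    rw [hgz, hgz] at h2
    simp only [hsn, mul_zero, neg_zero, exp_zero, mul_one, zero_add] at h2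
    rw [mul_comm c] at h2
    rw [← mul_left_cancel₀ hC h2]
    ring_nf
  · rw [hcont z hz, hgz, hsn]
    ring_nf

/-! ### The theta function -/

section Theta

variable {τ : ℂ}

theorem theta1_eq (τ z : ℂ) : theta1 τ z =
    -(exp (Real.pi * I * (z + 1 / 2) + Real.pi * I * τ / 4) *
      jacobiTheta₂ (z + 1 / 2 + τ / 2) τ) := by
  rw [theta1, jacobiTheta₂, ← tsum_mul_left]
  congr 1
  refine tsum_congr fun n => ?_
  rw [jacobiTheta₂_term, ← exp_add]
  ring_nf

theorem differentiable_theta1 (hτ : 0 < τ.im) : Differentiable ℂ (theta1 τ) := by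
  have h : theta1 τ = fun z => -(exp (Real.pi * I * (z + 1 / 2) + Real.pi * I * τ / 4) *
      jacobiTheta₂ (z + 1 / 2 + τ / 2) τ) := funext (theta1_eq τ)
  rw [h]
  intro z
  have h1 : DifferentiableAt ℂ (fun z => jacobiTheta₂ (z + 1 / 2 + τ / 2) τ) z :=
    (differentiableAt_jacobiTheta₂_fst (z + 1 / 2 + τ / 2) hτ).comp z
      (f := fun z => z + 1 / 2 + τ / 2) (by fun_prop)
  exact (DifferentiableAt.mul (by fun_prop) h1).neg

theorem theta1_neg (τ z : ℂ) : theta1 τ (-z) = -theta1 τ z := by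
  have h1 : jacobiTheta₂ (-z + 1 / 2 + τ / 2) τ = jacobiTheta₂ (z - 1 / 2 - τ / 2) τ := by
    rw [← jacobiTheta₂_neg_left]
    ring_nf
  have h2 : jacobiTheta₂ (z + 1 / 2 + τ / 2) τ =
      exp (-Real.pi * I * (τ + 2 * (z + 1 / 2 - τ / 2))) *
        jacobiTheta₂ (z - 1 / 2 - τ / 2) τ := by
    rw [show z + 1 / 2 + τ / 2 = (z + 1 / 2 - τ / 2) + τ by ring, jacobiTheta₂_add_left',
      show z + 1 / 2 - τ / 2 = (z - 1 / 2 - τ / 2) + 1 by ring, jacobiTheta₂_add_left]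
  rw [theta1_eq, theta1_eq, h1, h2, ← mul_assoc, ← exp_add,
    show (Real.pi * I * (-z + 1 / 2) + Real.pi * I * τ / 4 : ℂ) =
      (Real.pi * I * (z + 1 / 2) + Real.pi * I * τ / 4 +
        -Real.pi * I * (τ + 2 * (z + 1 / 2 - τ / 2))) + Real.pi * I by ring,
    exp_add _ (Real.pi * I : ℂ), exp_pi_mul_I]
  ring

theorem theta1_zero (τ : ℂ) : theta1 τ 0 = 0 := by
  have := theta1_neg τ 0
  rw [neg_zero] at this
  linear_combination this / 2

theorem theta1_add_one (τ z : ℂ) : theta1 τ (z + 1) = -theta1 τ z := by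
  rw [theta1_eq, theta1_eq, show z + 1 + 1 / 2 + τ / 2 = (z + 1 / 2 + τ / 2) + 1 by ring,
    jacobiTheta₂_add_left,
    show (Real.pi * I * (z + 1 + 1 / 2) + Real.pi * I * τ / 4 : ℂ) =
      (Real.pi * I * (z + 1 / 2) + Real.pi * I * τ / 4) + Real.pi * I by ring,
    exp_add _ (Real.pi * I : ℂ), exp_pi_mul_I]
  ring

theorem theta1_add_tau (τ z : ℂ) : theta1 τ (z + τ) =
    -exp (-(Real.pi * I * (2 * z + τ))) * theta1 τ z := by
  rw [theta1_eq, theta1_eq, show z + τ + 1 / 2 + τ / 2 = (z + 1 / 2 + τ / 2) + τ by ring,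
    jacobiTheta₂_add_left', ← mul_assoc, ← exp_add]
  rw [show (Real.pi * I * (z + τ + 1 / 2) + Real.pi * I * τ / 4 +
      -Real.pi * I * (τ + 2 * (z + 1 / 2 + τ / 2)) : ℂ) =
      (-(Real.pi * I * (2 * z + τ)) + (Real.pi * I * (z + 1 / 2) + Real.pi * I * τ / 4)) -
        Real.pi * I by ring, exp_sub _ (Real.pi * I : ℂ), exp_pi_mul_I, exp_add]
  ring

/-- Termwise integration leaves only the constant Fourier coefficient. This shows that `θ₁` is not
identically zero. -/
theorem integral_jacobiTheta₂ (hτ : 0 < τ.im) : ∫ x in (0 : ℝ)..1, jacobiTheta₂ x τ = 1 := by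
  let f : ℤ → C(ℝ, ℂ) := fun n => ⟨fun x => jacobiTheta₂_term n x τ, by
    unfold jacobiTheta₂_term; fun_prop⟩
  have hsum : Summable fun n => ‖(f n).restrict (⟨Set.uIcc 0 1, isCompact_uIcc⟩ :
      TopologicalSpace.Compacts ℝ)‖ := by
    have := ((summable_jacobiTheta₂_term_iff 0 τ).2 hτ).norm
    refine this.of_nonneg_of_le (fun _ => norm_nonneg _) fun n => ?_
    refine (ContinuousMap.norm_le _ (norm_nonneg _)).2 fun x => ?_
    change ‖jacobiTheta₂_term n ((x : ℝ) : ℂ) τ‖ ≤ _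
    rw [norm_jacobiTheta₂_term, norm_jacobiTheta₂_term]
    simp
  have h := intervalIntegral.hasSum_intervalIntegral_of_summable_norm hsum
  have hint : ∀ n, ∫ x in (0 : ℝ)..1, f n x = if n = 0 then 1 else 0 := by
    intro n
    change ∫ x in (0 : ℝ)..1, jacobiTheta₂_term n x τ = _
    split_ifs with hn
    · subst hn
      simp [jacobiTheta₂_term]
    · simp only [jacobiTheta₂_term, exp_add]
      rw [intervalIntegral.integral_mul_const, integral_exp_mul_complex]
      · have : exp (2 * Real.pi * I * n) = 1 := by
          rw [← exp_int_mul_two_pi_mul_I n]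
          ring_nf
        simp [this]
      · simp [hn, Real.pi_ne_zero]
  simp only [hint] at h
  have h2 : ∑' n, (if n = (0 : ℤ) then (1 : ℂ) else 0) = 1 := tsum_ite_eq 0 _
  rw [← h2, h.tsum_eq]
  rfl

theorem exists_theta1_ne_zero (hτ : 0 < τ.im) : ∃ z, theta1 τ z ≠ 0 := by
  by_contra! h
  have : ∀ z, jacobiTheta₂ z τ = 0 := by
    intro z
    have := h (z - 1 / 2 - τ / 2)
    rw [theta1_eq, show z - 1 / 2 - τ / 2 + 1 / 2 + τ / 2 = z by ring] at this
    simpa using this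
  have h1 := integral_jacobiTheta₂ hτ
  simp [this] at h1

/-! ### The product expansion -/

/-- The `q`-Pochhammer symbol `∏_{n ≥ 0} (1 - qⁿ w)`. -/
noncomputable def qPoch (q w : ℂ) : ℂ := ∏' n : ℕ, (1 + -(q ^ n * w))

variable {q : ℂ}

theorem summable_qPoch (hq : ‖q‖ < 1) (w : ℂ) : Summable fun n : ℕ => ‖-(q ^ n * w)‖ := by
  simpa using (summable_geometric_of_lt_one (norm_nonneg q) hq).mul_right ‖w‖

theorem qPoch_eq (hq : ‖q‖ < 1) (w : ℂ) : qPoch q w = (1 - w) * qPoch q (q * w) := by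
  rw [qPoch, tprod_eq_zero_mul', qPoch]
  · simp [pow_succ, mul_assoc, sub_eq_add_neg]
  · have := multipliable_one_add_of_summable (summable_qPoch hq (q * w))
    simpa [pow_succ, mul_assoc] using this

theorem qPoch_ne_zero (hq : ‖q‖ < 1) {w : ℂ} (h : ∀ n : ℕ, q ^ n * w ≠ 1) : qPoch q w ≠ 0 :=
  tprod_one_add_ne_zero_of_summable
    (fun n h' => h n (by linear_combination -h')) (summable_qPoch hq w)

theorem differentiable_qPoch (hq : ‖q‖ < 1) : Differentiable ℂ (qPoch q) := by
  intro w
  have hu : Summable fun n : ℕ => ‖q‖ ^ n * (‖w‖ + 1) :=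
    (summable_geometric_of_lt_one (norm_nonneg q) hq).mul_right _
  have h := Summable.hasProdLocallyUniformlyOn_nat_one_add (f := fun (n : ℕ) w => -(q ^ n * w))
    (Metric.isOpen_ball (x := w) (ε := 1)) hu (Eventually.of_forall fun n x hx => by
      rw [norm_neg, norm_mul, norm_pow]
      gcongr
      have := norm_sub_norm_le x w
      rw [Metric.mem_ball, dist_eq_norm] at hx
      linarith) (fun n => by fun_prop)
  have hd := h.differentiableOn (.of_forall fun s => by
    simpa [Finset.prod_fn] using DifferentiableOn.finsetProd (fun _ _ => by fun_prop))
    Metric.isOpen_ball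
  exact hd.differentiableAt (Metric.isOpen_ball.mem_nhds (Metric.mem_ball_self one_pos))

theorem norm_nome_lt_one (hτ : 0 < τ.im) : ‖exp (2 * Real.pi * I * τ)‖ < 1 := by
  rw [norm_exp, Real.exp_lt_one_iff]
  have : (2 * Real.pi * I * τ).re = -(2 * Real.pi * τ.im) := by simp
  rw [this]
  have := Real.pi_pos
  have : 0 < 2 * Real.pi * τ.im := by positivity
  linarith

/-- The part of the product expansion of `θ₁` that does not vanish at `0`. -/
noncomputable def thetaCofactor (τ z : ℂ) : ℂ :=
  qPoch (exp (2 * Real.pi * I * τ)) (exp (2 * Real.pi * I * τ) * exp (2 * Real.pi * I * z)) *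
    qPoch (exp (2 * Real.pi * I * τ)) (exp (2 * Real.pi * I * τ) * exp (-(2 * Real.pi * I * z)))

/-- The product `(1 - w) ∏_{n ≥ 1} (1 - qⁿ w) (1 - qⁿ w⁻¹)` with `w = exp (2πiz)`. -/
noncomputable def thetaProd (τ z : ℂ) : ℂ := (1 - exp (2 * Real.pi * I * z)) * thetaCofactor τ z

theorem differentiable_thetaCofactor (hτ : 0 < τ.im) : Differentiable ℂ (thetaCofactor τ) := by
  have h := differentiable_qPoch (norm_nome_lt_one hτ)
  unfold thetaCofactor
  exact (h.comp (by fun_prop)).mul (h.comp (by fun_prop))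

theorem differentiable_thetaProd (hτ : 0 < τ.im) : Differentiable ℂ (thetaProd τ) := by
  have := differentiable_thetaCofactor hτ
  unfold thetaProd
  fun_prop

theorem exp_eq_one_mem_lattice {n : ℤ} {z : ℂ}
    (h : exp (2 * Real.pi * I * (n * τ + z)) = 1) : z ∈ periodLattice τ := by
  obtain ⟨m, hm⟩ := exp_eq_one_iff.1 h
  refine ⟨m, -n, ?_⟩
  have : (2 * Real.pi * I : ℂ) * (n * τ + z - m) = 0 := by linear_combination hm
  rcases mul_eq_zero.1 this with h | h
  · exact absurd h two_pi_I_ne_zero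
  · push_cast
    linear_combination h

theorem thetaCofactor_ne_zero (hτ : 0 < τ.im) {z : ℂ}
    (hz : ∀ n : ℤ, n ≠ 0 → exp (2 * Real.pi * I * (n * τ + z)) ≠ 1) : thetaCofactor τ z ≠ 0 := by
  refine mul_ne_zero (qPoch_ne_zero (norm_nome_lt_one hτ) fun n h => hz (n + 1) (by omega) ?_)
    (qPoch_ne_zero (norm_nome_lt_one hτ) fun n h => hz (-(n + 1)) (by omega) ?_)
  · rw [← h, ← exp_nat_mul, ← exp_add, ← exp_add]
    push_cast
    ring_nf
  · rw [← inv_eq_one, ← exp_neg, ← h, ← exp_nat_mul, ← exp_add, ← exp_add]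
    push_cast
    ring_nf

theorem thetaProd_ne_zero (hτ : 0 < τ.im) {z : ℂ} (hz : z ∉ periodLattice τ) :
    thetaProd τ z ≠ 0 := by
  refine mul_ne_zero (fun h => hz (exp_eq_one_mem_lattice (n := 0) ?_))
    (thetaCofactor_ne_zero hτ fun n _ h => hz (exp_eq_one_mem_lattice h))
  rw [Int.cast_zero, zero_mul, zero_add]
  linear_combination -h

theorem thetaCofactor_zero_ne_zero (hτ : 0 < τ.im) : thetaCofactor τ 0 ≠ 0 := by
  refine thetaCofactor_ne_zero hτ fun n hn h => ?_
  rw [add_zero] at h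
  obtain ⟨m, hm⟩ := exp_eq_one_iff.1 h
  have : (2 * Real.pi * I : ℂ) * (n * τ - m) = 0 := by linear_combination hm
  rcases mul_eq_zero.1 this with h | h
  · exact absurd h two_pi_I_ne_zero
  · have := congrArg im h
    simp [hn, hτ.ne'] at this

theorem thetaProd_add_one (τ z : ℂ) : thetaProd τ (z + 1) = thetaProd τ z := by
  simp [thetaProd, thetaCofactor, mul_add, exp_add, exp_neg]

theorem thetaProd_add_tau (hτ : 0 < τ.im) (z : ℂ) :
    thetaProd τ (z + τ) = -exp (-(2 * Real.pi * I * z)) * thetaProd τ z := by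
  have hq := norm_nome_lt_one hτ
  have e0 : exp (2 * Real.pi * I * (z + τ)) =
      exp (2 * Real.pi * I * τ) * exp (2 * Real.pi * I * z) := by
    rw [← exp_add]; ring_nf
  have e1 : exp (2 * Real.pi * I * τ) * exp (-(2 * Real.pi * I * (z + τ))) =
      exp (-(2 * Real.pi * I * z)) := by
    rw [← exp_add]; ring_nf
  have e2 : exp (-(2 * Real.pi * I * z)) * exp (2 * Real.pi * I * z) = 1 := by
    rw [← exp_add]; simp
  unfold thetaProd thetaCofactor
  rw [e1, e0, ← mul_assoc, ← qPoch_eq hq, qPoch_eq hq (exp (-(2 * Real.pi * I * z))),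
    qPoch_eq hq (exp (2 * Real.pi * I * τ) * exp (2 * Real.pi * I * z))]
  linear_combination (-(1 - exp (2 * Real.pi * I * τ) * exp (2 * Real.pi * I * z)) *
    qPoch (exp (2 * Real.pi * I * τ)) (exp (2 * Real.pi * I * τ) *
      (exp (2 * Real.pi * I * τ) * exp (2 * Real.pi * I * z))) *
    qPoch (exp (2 * Real.pi * I * τ)) (exp (2 * Real.pi * I * τ) * exp (-(2 * Real.pi * I * z)))) * e2

/-- An invariance under the generators of the lattice is an invariance under the lattice. -/
theorem lattice_invariant {f : ℂ → ℂ} (h1 : ∀ z, f (z + 1) = f z) (hq : ∀ z, f (z + τ) = f z)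
    {l : ℂ} (hl : l ∈ periodLattice τ) (z : ℂ) : f (z + l) = f z := by
  have hnm : ∀ (a : ℂ), (∀ z, f (z + a) = f z) → ∀ (m : ℤ) z, f (z + m * a) = f z := by
    intro a ha m z
    have : Function.Periodic f a := ha
    exact this.int_mul m z
  obtain ⟨m, n, rfl⟩ := hl
  rw [← add_assoc, hnm τ hq, ← mul_one (m : ℂ), hnm 1 h1]

/-- The triple product up to an undetermined constant: both sides have the same factors of
automorphy, so their quotient is doubly periodic. The zero of `θ₁` at `0` cancels the simple zero of
the product, so the quotient is constant. Only `C ≠ 0` is needed later. -/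
theorem exists_theta1_eq_thetaProd (hτ : 0 < τ.im) :
    ∃ C ≠ 0, ∀ z ∉ periodLattice τ, exp (Real.pi * I * z) * theta1 τ z = C * thetaProd τ z := by
  set N : ℂ → ℂ := fun z => exp (Real.pi * I * z) * theta1 τ z with hN
  have hNd : Differentiable ℂ N := by
    have := differentiable_theta1 hτ
    fun_prop
  have hPd := differentiable_thetaProd hτ
  set H : ℂ → ℂ := fun z => N z / thetaProd τ z with hH
  have hH1 : ∀ z, H (z + 1) = H z := by
    intro z
    simp only [hH, hN, thetaProd_add_one, theta1_add_one, mul_add, mul_one, exp_add, exp_pi_mul_I]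
    ring_nf
  have hHτ : ∀ z, H (z + τ) = H z := by
    intro z
    have : N (z + τ) = -exp (-(2 * Real.pi * I * z)) * N z := by
      simp only [hN]
      rw [theta1_add_tau]
      have : exp (Real.pi * I * (z + τ)) * exp (-(Real.pi * I * (2 * z + τ))) =
          exp (-(2 * Real.pi * I * z)) * exp (Real.pi * I * z) := by
        rw [← exp_add, ← exp_add]
        ring_nf
      linear_combination -theta1 τ z * this
    simp only [hH]
    rw [this, thetaProd_add_tau hτ, mul_div_mul_left _ _ (neg_ne_zero.2 (exp_ne_zero _))]
  have hHc : ∀ z ∉ periodLattice τ, ContinuousAt H z := fun z hz =>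
    hNd.continuous.continuousAt.div hPd.continuous.continuousAt (thetaProd_ne_zero hτ hz)
  -- Here `w / (1 - exp (2πiw))` has a finite limit, the cofactor is nonzero at `0`, and `N` tends
  -- to `N 0 = 0`.
  have hH0 : Tendsto (fun w => w * H w) (𝓝[≠] 0) (𝓝 0) := by
    have hE : HasDerivAt (fun w : ℂ => 1 - exp (2 * Real.pi * I * w)) (-(2 * Real.pi * I)) 0 := by
      have := ((hasDerivAt_id (0 : ℂ)).const_mul (2 * Real.pi * I)).cexp.const_sub 1
      simpa using this
    have hE' := (hasDerivAt_iff_tendsto_slope.1 hE).inv₀ (neg_ne_zero.2 two_pi_I_ne_zero)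
    have hN0 : Tendsto N (𝓝[≠] 0) (𝓝 0) := by
      have := (hNd.continuous.tendsto 0).mono_left (nhdsWithin_le_nhds (s := {0}ᶜ))
      simpa [hN, theta1_zero] using this
    have hB := (((differentiable_thetaCofactor hτ).continuous.tendsto 0).mono_left
      (nhdsWithin_le_nhds (s := {0}ᶜ))).inv₀ (thetaCofactor_zero_ne_zero hτ)
    have := (hN0.mul hE').mul hB
    simp only [zero_mul] at this
    refine this.congr fun w => ?_
    simp only [hH, slope_def_field, thetaProd, mul_zero, exp_zero, sub_self, sub_zero, inv_div]
    rw [div_eq_mul_inv, div_eq_mul_inv, mul_inv]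
    ring
  obtain ⟨C, n, hCn, hC⟩ := liouville_quasiperiodic hτ one_ne_zero (f := H)
    (fun z => (hNd.analyticAt z).meromorphicAt.div (hPd.analyticAt z).meromorphicAt)
    (fun z => by
      by_cases hz : z ∈ periodLattice τ
      · have ht : Tendsto (fun w : ℂ => w - z) (𝓝[≠] z) (𝓝[≠] 0) := by
          apply tendsto_nhdsWithin_of_tendsto_nhds_of_eventually_within
          · have : Tendsto (fun w : ℂ => w - z) (𝓝 z) (𝓝 (z - z)) :=
              Continuous.tendsto (by fun_prop) _
            rw [sub_self] at this
            exact this.mono_left nhdsWithin_le_nhds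
          · filter_upwards [self_mem_nhdsWithin] with t ht
            simpa [sub_eq_zero] using ht
        refine (hH0.comp ht).congr fun w => ?_
        rw [Function.comp_apply, sub_eq_add_neg w z,
          lattice_invariant hH1 hHτ (neg_mem_periodLattice hz)]
      · have h1 : Tendsto (fun w : ℂ => w - z) (𝓝 z) (𝓝 (z - z)) :=
          Continuous.tendsto (by fun_prop) _
        have := h1.mul (hHc z hz)
        rw [sub_self, zero_mul] at this
        exact this.mono_left nhdsWithin_le_nhds)
    hH1 (by simpa using hHτ)
  -- The multiplier is `1`, and `exp (2πinτ) = 1` forces `n = 0` because `Im τ > 0`.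
  have hn : C ≠ 0 → n = 0 := by
    intro h
    obtain ⟨m, hm⟩ := exp_eq_one_iff.1 (hCn h).symm
    have : (2 * Real.pi * I : ℂ) * (n * τ - m) = 0 := by linear_combination hm
    rcases mul_eq_zero.1 this with h | h
    · exact absurd h two_pi_I_ne_zero
    · have := congrArg im h
      simpa [hτ.ne'] using this
  have key : ∀ z ∉ periodLattice τ, N z = C * thetaProd τ z := by
    intro z hz
    have h1 := hC z (hHc z hz)
    rw [hH, div_eq_iff (thetaProd_ne_zero hτ hz)] at h1
    rw [h1]
    by_cases hC0 : C = 0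
    · simp [hC0]
    · simp [hn hC0]
  refine ⟨C, ?_, key⟩
  rintro rfl
  obtain ⟨z, hz⟩ := exists_theta1_ne_zero hτ
  have hz' : N z ≠ 0 := mul_ne_zero (exp_ne_zero _) hz
  -- The identity `key` holds only off the lattice, so `z` is moved to a nearby non-lattice point
  -- where `N` is still nonzero.
  have h1 : ∀ᶠ w in 𝓝[≠] z, N w ≠ 0 :=
    (hNd.continuous.continuousAt.eventually_ne hz').filter_mono nhdsWithin_le_nhds
  obtain ⟨w, hw, hw'⟩ := (h1.and (eventually_notMem_periodLattice hτ z)).exists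
  exact hw (by rw [key w hw', zero_mul])

theorem theta1_ne_zero (hτ : 0 < τ.im) {z : ℂ} (hz : z ∉ periodLattice τ) : theta1 τ z ≠ 0 := by
  obtain ⟨C, hC, h⟩ := exists_theta1_eq_thetaProd hτ
  have := h z hz
  intro h0
  rw [h0, mul_zero] at this
  exact mul_ne_zero hC (thetaProd_ne_zero hτ hz) this.symm

theorem deriv_theta1_zero_ne_zero (hτ : 0 < τ.im) : deriv (theta1 τ) 0 ≠ 0 := by
  obtain ⟨C, hC, h⟩ := exists_theta1_eq_thetaProd hτ
  have h1 : HasDerivAt (fun z => exp (Real.pi * I * z) * theta1 τ z) (deriv (theta1 τ) 0) 0 := by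
    have := (((hasDerivAt_id (0 : ℂ)).const_mul (Real.pi * I)).cexp).fun_mul
      (differentiable_theta1 hτ 0).hasDerivAt
    simpa [theta1_zero] using this
  have h2 : HasDerivAt (fun z => C * thetaProd τ z)
      (C * (-(2 * Real.pi * I) * thetaCofactor τ 0)) 0 := by
    have := ((((hasDerivAt_id (0 : ℂ)).const_mul (2 * Real.pi * I)).cexp.const_sub 1).fun_mul
      (differentiable_thetaCofactor hτ 0).hasDerivAt).const_mul C
    simpa [thetaProd] using this
  have h3 : (fun z => exp (Real.pi * I * z) * theta1 τ z) =ᶠ[𝓝 0] fun z => C * thetaProd τ z := by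
    have := eventually_nhdsWithin_iff.1 (eventually_notMem_periodLattice hτ 0)
    filter_upwards [this] with z hz
    by_cases hz0 : z = 0
    · simp [hz0, theta1_zero, thetaProd]
    · exact h z (hz hz0)
  rw [h1.unique (h2.congr_of_eventuallyEq h3)]
  exact mul_ne_zero hC (mul_ne_zero (neg_ne_zero.2 two_pi_I_ne_zero)
    (thetaCofactor_zero_ne_zero hτ))

end Theta

/-! ### The functions `σ_μ` -/

section Sigma

variable {τ : ℂ}

/-- The factor of automorphy of `σ_μ`, extended to `ℂ` as a real-analytic character: its value
at `m + n τ` is `exp (2πinμ)`. -/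
noncomputable def latChar (τ μ z : ℂ) : ℂ := exp (2 * Real.pi * I * ((z.im / τ.im : ℝ) : ℂ) * μ)

theorem latChar_ne_zero (τ μ z : ℂ) : latChar τ μ z ≠ 0 := exp_ne_zero _

theorem latChar_add (τ μ z w : ℂ) : latChar τ μ (z + w) = latChar τ μ z * latChar τ μ w := by
  simp only [latChar, ← exp_add, add_im, add_div, ofReal_add]
  ring_nf

theorem latChar_add_left (τ μ ν z : ℂ) :
    latChar τ (μ + ν) z = latChar τ μ z * latChar τ ν z := by
  simp only [latChar, ← exp_add]
  ring_nf

theorem latChar_int_mul (τ μ z : ℂ) (n : ℤ) : latChar τ μ (n * z) = latChar τ (n * μ) z := by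
  simp only [latChar]
  congr 1
  rw [show ((n : ℂ) * z).im = n * z.im by simp]
  push_cast
  ring

theorem latChar_one (τ μ : ℂ) : latChar τ μ 1 = 1 := by simp [latChar]

theorem latChar_tau (hτ : 0 < τ.im) (μ : ℂ) : latChar τ μ τ = exp (2 * Real.pi * I * μ) := by
  simp [latChar, hτ.ne']

theorem ellSigma_add_one (τ μ z : ℂ) : ellSigma τ μ (z + 1) = ellSigma τ μ z := by
  rw [ellSigma, add_sub_right_comm, theta1_add_one, theta1_add_one, ellSigma, neg_mul, neg_mul,
    neg_div_neg_eq]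

theorem ellSigma_add_tau (τ μ z : ℂ) :
    ellSigma τ μ (z + τ) = exp (2 * Real.pi * I * μ) * ellSigma τ μ z := by
  have h : exp (-(Real.pi * I * (2 * (z - μ) + τ))) =
      exp (2 * Real.pi * I * μ) * exp (-(Real.pi * I * (2 * z + τ))) := by
    rw [← exp_add]
    ring_nf
  rw [ellSigma, add_sub_right_comm, theta1_add_tau, theta1_add_tau, ellSigma, h, ← mul_div_assoc,
    ← mul_div_mul_left (c := -exp (-(Real.pi * I * (2 * z + τ)))) _ (theta1 τ z * theta1 τ (-μ))
      (neg_ne_zero.2 (exp_ne_zero _))]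
  ring_nf

/-- Since `latChar` is a character of the whole plane with the right values at `1` and `τ`, the
quotient `σ_μ / latChar` is invariant under the generators, hence under the lattice. -/
theorem ellSigma_add_lattice (hτ : 0 < τ.im) (μ : ℂ) {l : ℂ} (hl : l ∈ periodLattice τ) (z : ℂ) :
    ellSigma τ μ (z + l) = latChar τ μ l * ellSigma τ μ z := by
  have h := lattice_invariant (f := fun z => ellSigma τ μ z / latChar τ μ z)
    (fun z => by rw [ellSigma_add_one, latChar_add, latChar_one, mul_one])
    (fun z => by
      rw [ellSigma_add_tau, latChar_add, latChar_tau hτ, mul_comm (latChar τ μ z),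
        mul_div_mul_left _ _ (exp_ne_zero _)]) hl z
  simp only [latChar_add] at h
  rw [div_eq_div_iff (mul_ne_zero (latChar_ne_zero _ _ _) (latChar_ne_zero _ _ _))
    (latChar_ne_zero _ _ _)] at h
  apply mul_right_cancel₀ (latChar_ne_zero τ μ z)
  linear_combination h

theorem ellSigma_neg_neg (τ μ z : ℂ) : ellSigma τ (-μ) (-z) = -ellSigma τ μ z := by
  rw [ellSigma, ellSigma, show -z - -μ = -(z - μ) by ring, theta1_neg, theta1_neg, theta1_neg τ μ,
    neg_neg, neg_mul, neg_mul, mul_neg, ← neg_div]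

theorem continuousAt_ellSigma (hτ : 0 < τ.im) {μ z : ℂ} (hμ : μ ∉ periodLattice τ)
    (hz : z ∉ periodLattice τ) : ContinuousAt (fun p : ℂ × ℂ => ellSigma τ p.1 p.2) (μ, z) := by
  have hc := (differentiable_theta1 hτ).continuous
  unfold ellSigma
  refine ContinuousAt.div ?_ ?_ (mul_ne_zero (theta1_ne_zero hτ hz)
    (theta1_ne_zero hτ (mt neg_mem_periodLattice_iff.1 hμ)))
  · exact Continuous.continuousAt (by fun_prop)
  · exact Continuous.continuousAt (by fun_prop)

theorem differentiableAt_ellSigma (hτ : 0 < τ.im) {μ z : ℂ} (hμ : μ ∉ periodLattice τ)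
    (hz : z ∉ periodLattice τ) : DifferentiableAt ℂ (ellSigma τ μ) z := by
  have hc := differentiable_theta1 hτ
  unfold ellSigma
  refine DifferentiableAt.div ?_ ?_ (mul_ne_zero (theta1_ne_zero hτ hz)
    (theta1_ne_zero hτ (mt neg_mem_periodLattice_iff.1 hμ)))
  · fun_prop
  · fun_prop

theorem meromorphicAt_ellSigma (hτ : 0 < τ.im) (μ a b t₀ : ℂ) :
    MeromorphicAt (fun t => ellSigma τ μ (a + t * b)) t₀ := by
  have hc := differentiable_theta1 hτ
  have h1 : Differentiable ℂ fun t => theta1 τ (a + t * b - μ) * deriv (theta1 τ) 0 := by fun_prop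
  have h2 : Differentiable ℂ fun t => theta1 τ (a + t * b) * theta1 τ (-μ) := by fun_prop
  exact (h1.analyticAt t₀).meromorphicAt.div (h2.analyticAt t₀).meromorphicAt

theorem tendsto_mul_ellSigma_zero (hτ : 0 < τ.im) {μ : ℂ} (hμ : μ ∉ periodLattice τ) :
    Tendsto (fun u => u * ellSigma τ μ u) (𝓝[≠] 0) (𝓝 1) := by
  have hd := differentiable_theta1 hτ
  have hd0 := deriv_theta1_zero_ne_zero hτ
  have hm := theta1_ne_zero hτ (mt neg_mem_periodLattice_iff.1 hμ)
  have h1 := (hasDerivAt_iff_tendsto_slope.1 (hd 0).hasDerivAt).inv₀ hd0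
  have h2 : Tendsto (fun u => theta1 τ (u - μ)) (𝓝[≠] 0) (𝓝 (theta1 τ (0 - μ))) :=
    (Continuous.tendsto (hd.continuous.comp (by fun_prop)) _).mono_left nhdsWithin_le_nhds
  have h3 := ((h2.mul_const (deriv (theta1 τ) 0)).div_const (theta1 τ (-μ))).mul h1
  have h4 : theta1 τ (0 - μ) * deriv (theta1 τ) 0 / theta1 τ (-μ) * (deriv (theta1 τ) 0)⁻¹ = 1 := by
    rw [zero_sub]
    field_simp
  rw [h4] at h3
  refine h3.congr fun u => ?_
  rw [slope_def_field, theta1_zero, sub_zero, sub_zero, inv_div, ellSigma]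
  rw [div_mul_div_comm, ← mul_div_assoc]
  ring_nf

open scoped Classical in
/-- The residue of `σ_μ` at `z`. -/
noncomputable def sigmaRes (τ μ z : ℂ) : ℂ := if z ∈ periodLattice τ then latChar τ μ z else 0

theorem sigmaRes_of_mem {μ z : ℂ} (h : z ∈ periodLattice τ) : sigmaRes τ μ z = latChar τ μ z :=
  if_pos h

theorem sigmaRes_of_notMem {μ z : ℂ} (h : z ∉ periodLattice τ) : sigmaRes τ μ z = 0 := if_neg h

theorem continuousAt_ellSigma_line (hτ : 0 < τ.im) {μ : ℂ} (hμ : μ ∉ periodLattice τ)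
    {a b t₀ : ℂ} (h : a + t₀ * b ∉ periodLattice τ) :
    ContinuousAt (fun t => ellSigma τ μ (a + t * b)) t₀ :=
  ContinuousAt.comp (f := fun t => a + t * b) (g := ellSigma τ μ)
    (differentiableAt_ellSigma hτ hμ h).continuousAt (Continuous.continuousAt (by fun_prop))

theorem tendsto_sub_self (t₀ : ℂ) : Tendsto (fun t : ℂ => t - t₀) (𝓝[≠] t₀) (𝓝 0) := by
  have : Tendsto (fun w : ℂ => w - t₀) (𝓝 t₀) (𝓝 (t₀ - t₀)) := Continuous.tendsto (by fun_prop) _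
  rw [sub_self] at this
  exact this.mono_left nhdsWithin_le_nhds

/-- The residue is that of `u ↦ u σ_μ(u)` at `0`, transported by a lattice translation and the
scaling by `b`. If `b = 0`, the hypothesis makes `sigmaRes` vanish, and the value `0 / 0 = 0` is the
correct limit. -/
theorem tendsto_mul_ellSigma_line (hτ : 0 < τ.im) {μ : ℂ} (hμ : μ ∉ periodLattice τ) (a b t₀ : ℂ)
    (h : b = 0 → a ∉ periodLattice τ) :
    Tendsto (fun t => (t - t₀) * ellSigma τ μ (a + t * b)) (𝓝[≠] t₀)
      (𝓝 (sigmaRes τ μ (a + t₀ * b) / b)) := by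
  by_cases hl : a + t₀ * b ∈ periodLattice τ
  · have hb : b ≠ 0 := by
      rintro rfl
      exact h rfl (by simpa using hl)
    have ht : Tendsto (fun t : ℂ => (t - t₀) * b) (𝓝[≠] t₀) (𝓝[≠] 0) := by
      apply tendsto_nhdsWithin_of_tendsto_nhds_of_eventually_within
      · simpa using (tendsto_sub_self t₀).mul_const b
      · filter_upwards [self_mem_nhdsWithin] with t ht
        simpa [hb, sub_eq_zero] using ht
    rw [sigmaRes_of_mem hl]
    have := ((tendsto_mul_ellSigma_zero hτ hμ).comp ht).mul_const (latChar τ μ (a + t₀ * b) / b)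
    rw [one_mul] at this
    refine this.congr fun t => ?_
    rw [Function.comp_apply, show a + t * b = (t - t₀) * b + (a + t₀ * b) by ring,
      ellSigma_add_lattice hτ μ hl]
    field_simp
  · rw [sigmaRes_of_notMem hl, zero_div, ← zero_mul (ellSigma τ μ (a + t₀ * b))]
    exact (tendsto_sub_self t₀).mul
      ((continuousAt_ellSigma_line hτ hμ hl).tendsto.mono_left nhdsWithin_le_nhds)

/-- The polar part of a product of two functions `σ_μ` whose poles are distinct. -/
theorem tendsto_mul_ellSigma_mul_ellSigma (hτ : 0 < τ.im) {μ ν : ℂ} (hμ : μ ∉ periodLattice τ)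
    (hν : ν ∉ periodLattice τ) (a b c d t₀ : ℂ) (hb : b = 0 → a ∉ periodLattice τ)
    (hd : d = 0 → c ∉ periodLattice τ)
    (h : a + t₀ * b ∈ periodLattice τ → c + t₀ * d ∉ periodLattice τ) :
    Tendsto (fun t => (t - t₀) * (ellSigma τ μ (a + t * b) * ellSigma τ ν (c + t * d))) (𝓝[≠] t₀)
      (𝓝 (sigmaRes τ μ (a + t₀ * b) / b * ellSigma τ ν (c + t₀ * d) +
        sigmaRes τ ν (c + t₀ * d) / d * ellSigma τ μ (a + t₀ * b))) := by
  by_cases hc : c + t₀ * d ∈ periodLattice τ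
  · have ha : a + t₀ * b ∉ periodLattice τ := fun h' => h h' hc
    rw [sigmaRes_of_notMem ha, zero_div, zero_mul, zero_add]
    refine ((tendsto_mul_ellSigma_line hτ hν c d t₀ hd).mul
      ((continuousAt_ellSigma_line hτ hμ ha).tendsto.mono_left nhdsWithin_le_nhds)).congr
      fun t => by ring
  · rw [sigmaRes_of_notMem hc, zero_div, zero_mul, add_zero]
    refine ((tendsto_mul_ellSigma_line hτ hμ a b t₀ hb).mul
      ((continuousAt_ellSigma_line hτ hν hc).tendsto.mono_left nhdsWithin_le_nhds)).congr
      fun t => by ring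

end Sigma

/-! ### Reflections and coroots -/

section Reflections

variable {V : Type*} [NormedAddCommGroup V] [InnerProductSpace ℝ V]

theorem isometry_mul_apply (v w : V ≃ₗᵢ[ℝ] V) (x : V) : (v * w) x = v (w x) := rfl

theorem refl_apply (α x : V) : refl α x = x - ⟪coroot α, x⟫_ℝ • α := by
  rw [refl, Submodule.reflection_orthogonal_apply, Submodule.reflection_singleton_apply, coroot,
    real_inner_smul_left, real_inner_self_eq_norm_sq]
  simp only [RCLike.ofReal_real_eq_id, id_eq, neg_sub, two_smul, ← add_smul]
  ring_nf

theorem inner_coroot_smul (α x : V) : ⟪coroot α, x⟫_ℝ • α = ⟪α, x⟫_ℝ • coroot α := by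
  rw [coroot, real_inner_smul_left, smul_smul]
  ring_nf

theorem refl_apply' (α x : V) : refl α x = x - ⟪α, x⟫_ℝ • coroot α := by
  rw [refl_apply, inner_coroot_smul]

theorem refl_refl (α x : V) : refl α (refl α x) = x := Submodule.reflection_reflection _ x

theorem refl_mul_self (α : V) : refl α * refl α = 1 := by
  ext x
  exact refl_refl α x

theorem refl_inv (α : V) : (refl α)⁻¹ = refl α := inv_eq_of_mul_eq_one_left (refl_mul_self α)

theorem refl_self (α : V) : refl α α = -α := by
  rw [refl, Submodule.reflection_orthogonalComplement_singleton_eq_neg]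

theorem refl_smul {c : ℝ} (hc : c ≠ 0) (α : V) : refl (c • α) = refl α := by
  rw [refl, refl]
  congr 2
  exact Submodule.span_singleton_smul_eq (IsUnit.mk0 c hc) α

theorem refl_neg (α : V) : refl (-α) = refl α := by
  simpa using refl_smul (c := -1) (by norm_num) α

theorem coroot_map (w : V ≃ₗᵢ[ℝ] V) (α : V) : coroot (w α) = w (coroot α) := by
  rw [coroot, coroot, w.inner_map_map, map_smul]

theorem coroot_neg (α : V) : coroot (-α) = -coroot α := by simp [coroot]

theorem refl_map (w : V ≃ₗᵢ[ℝ] V) (α : V) : refl (w α) = w * refl α * w⁻¹ := by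
  ext x
  obtain ⟨y, rfl⟩ := w.surjective x
  have h : w⁻¹ (w y) = y := w.symm_apply_apply y
  rw [isometry_mul_apply, isometry_mul_apply, h, refl_apply, refl_apply,
    coroot_map, w.inner_map_map, map_sub, map_smul]

theorem refl_refl_eq (α β : V) : refl (refl α β) = refl α * refl β * refl α := by
  rw [refl_map, refl_inv]

theorem inner_refl (α x y : V) : ⟪refl α x, y⟫_ℝ = ⟪x, refl α y⟫_ℝ := by
  rw [← (refl α).inner_map_map, refl_refl]

/-- The key identity: the right-hand side depends on the pair of roots only through `r`. It makes
all terms of a functional equation share one factor of automorphy along the line in direction `p`.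
-/
theorem inner_smul_coroot_add {α β : V} {r : V ≃ₗᵢ[ℝ] V} (h : refl α * refl β = r) (p : V) :
    ⟪α, p⟫_ℝ • coroot α + ⟪refl α β, p⟫_ℝ • coroot β = p - r⁻¹ p := by
  rw [← h, mul_inv_rev, refl_inv, refl_inv, isometry_mul_apply, refl_apply' β,
    inner_refl, refl_apply' α p]
  abel

variable {R : Finset V}

theorem IsReducedRootSystem.ne_zero (hR : IsReducedRootSystem R) {α : V} (hα : α ∈ R) : α ≠ 0 :=
  fun h => hR.zero_notMem (h ▸ hα)

theorem IsReducedRootSystem.neg_mem (hR : IsReducedRootSystem R) {α : V} (hα : α ∈ R) :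
    -α ∈ R := by
  rw [← refl_self]
  exact hR.refl_mem α hα α hα

theorem IsReducedRootSystem.map_mem (hR : IsReducedRootSystem R) {w : V ≃ₗᵢ[ℝ] V}
    (hw : w ∈ weylGroup R) : ∀ α ∈ R, w α ∈ R := by
  induction hw using Subgroup.closure_induction with
  | mem w h =>
    obtain ⟨β, hβ, rfl⟩ := h
    exact hR.refl_mem β hβ
  | one => exact fun α h => h
  | mul v w _ _ hv hw => exact fun α h => hv _ (hw _ h)
  | inv w _ hw =>
    intro α h
    have hinj : Set.InjOn w (R : Set V) := w.injective.injOn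
    obtain ⟨β, hβ, rfl⟩ := Finset.surjOn_of_injOn_of_card_le w hw hinj le_rfl h
    have : w⁻¹ (w β) = β := w.symm_apply_apply β
    rwa [this]

theorem refl_mem_weylGroup {α : V} (hα : α ∈ R) : refl α ∈ weylGroup R :=
  Subgroup.subset_closure ⟨α, hα, rfl⟩

/-- A nontrivial isometry moves a coroot. -/
theorem IsReducedRootSystem.exists_coroot_ne (hR : IsReducedRootSystem R) {r : V ≃ₗᵢ[ℝ] V}
    (hr : r ≠ 1) : ∃ α ∈ R, r (coroot α) ≠ coroot α := by
  by_contra! h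
  apply hr
  have : (r.toLinearEquiv : V →ₗ[ℝ] V) = LinearMap.id := by
    apply LinearMap.ext_on hR.span_eq_top
    intro α hα
    have h1 := h α hα
    have h2 : (2 / ⟪α, α⟫_ℝ) ≠ 0 :=
      div_ne_zero two_ne_zero (inner_self_ne_zero.2 (hR.ne_zero hα))
    rw [coroot, map_smul] at h1
    exact smul_right_injective V h2 h1
  ext x
  exact LinearMap.congr_fun this x

/-- Finitely many nonzero vectors are simultaneously non-orthogonal to some vector. -/
theorem exists_inner_ne_zero {ι : Type*} (s : Finset ι) (u : ι → V) (hu : ∀ i ∈ s, u i ≠ 0) :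
    ∃ q : V, ∀ i ∈ s, ⟪q, u i⟫_ℝ ≠ 0 := by
  classical
  by_contra! h
  have h1 : (⋃ K ∈ s.image fun i => (ℝ ∙ u i)ᗮ, (K : Set V)) = Set.univ := by
    refine Set.eq_univ_of_forall fun q => ?_
    obtain ⟨i, hi, hq⟩ := h q
    refine Set.mem_biUnion (Finset.mem_image_of_mem _ hi) ?_
    rw [SetLike.mem_coe, Submodule.mem_orthogonal_singleton_iff_inner_left]
    exact hq
  refine Subspace.biUnion_ne_univ_of_top_notMem ?_ h1
  intro ht
  obtain ⟨i, hi, h⟩ := Finset.mem_image.1 ht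
  have : u i ∈ (ℝ ∙ u i)ᗮ := h ▸ Submodule.mem_top
  rw [Submodule.mem_orthogonal_singleton_iff_inner_left] at this
  exact hu i hi (inner_self_eq_zero.1 this)

end Reflections

/-! ### The functional equations, summed over all roots -/

section Core

variable {V : Type*} [NormedAddCommGroup V] [InnerProductSpace ℝ V]

/-- The summand of the functional equations at the point `X = (·, x)` for the
parameter `M = (·, λ)`. -/
noncomputable def pairTerm (τ : ℂ) (k : V → ℂ) (M X : V →ₗ[ℝ] ℂ) (α β : V) : ℂ :=
  k α * ellSigma τ (M (coroot α)) (X α) * (k β * ellSigma τ (M (coroot β)) (X (refl α β)))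

open scoped Classical in
/-- The pairs of roots whose reflections have product `r`. -/
noncomputable def rotationPairs (R : Finset V) (r : V ≃ₗᵢ[ℝ] V) : Finset (V × V) :=
  (R ×ˢ R).filter fun p => refl p.1 * refl p.2 = r

theorem mem_rotationPairs {R : Finset V} {r : V ≃ₗᵢ[ℝ] V} {p : V × V} :
    p ∈ rotationPairs R r ↔ p.1 ∈ R ∧ p.2 ∈ R ∧ refl p.1 * refl p.2 = r := by
  simp [rotationPairs, and_assoc]

theorem alternating_swap {ω : V →ₗ[ℝ] V →ₗ[ℝ] ℂ} (hω : ∀ v, ω v v = 0) (u v : V) :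
    ω u v = -ω v u := by
  have := hω (u + v)
  simp only [map_add, LinearMap.add_apply, hω] at this
  linear_combination this

variable {R : Finset V} {τ : ℂ} {k : V → ℂ} {r : V ≃ₗᵢ[ℝ] V}

/-- The residues of the terms of the functional equations cancel in pairs. -/
theorem sum_residues_eq_zero (hR : IsReducedRootSystem R) (hτ : 0 < τ.im)
    (hk : ∀ α ∈ R, ∀ β ∈ R, k (refl α β) = k β) {ω : V →ₗ[ℝ] V →ₗ[ℝ] ℂ} (hω : ∀ v, ω v v = 0)
    (M X P : V →ₗ[ℝ] ℂ) :
    ∑ p ∈ rotationPairs R r, ω p.1 p.2 * (k p.1 * k p.2) *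
      (sigmaRes τ (M (coroot p.1)) (X p.1) / P p.1 *
          ellSigma τ (M (coroot p.2)) (X (refl p.1 p.2)) +
        sigmaRes τ (M (coroot p.2)) (X (refl p.1 p.2)) / P (refl p.1 p.2) *
          ellSigma τ (M (coroot p.1)) (X p.1)) = 0 := by
  simp only [mul_add, Finset.sum_add_distrib]
  rw [add_eq_zero_iff_eq_neg, ← Finset.sum_neg_distrib]
  -- The first factor of `(α, β)` and the second factor of `(β, s_β α)` have the same argument `X
  -- α`, because `s_β (s_β α) = α`; the product of reflections is again `r`.
  refine Finset.sum_nbij' (fun p => (p.2, refl p.2 p.1)) (fun p => (refl p.1 p.2, p.1)) ?_ ?_ ?_ ?_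
    ?_
  · rintro ⟨α, β⟩ h
    obtain ⟨hα, hβ, h⟩ := mem_rotationPairs.1 h
    refine mem_rotationPairs.2 ⟨hβ, hR.refl_mem β hβ α hα, ?_⟩
    dsimp only at h ⊢
    rw [refl_refl_eq, ← h, ← mul_assoc, ← mul_assoc, refl_mul_self, one_mul]
  · rintro ⟨α, β⟩ h
    obtain ⟨hα, hβ, h⟩ := mem_rotationPairs.1 h
    refine mem_rotationPairs.2 ⟨hR.refl_mem α hα β hβ, hα, ?_⟩
    dsimp only at h ⊢
    rw [refl_refl_eq, mul_assoc, refl_mul_self, mul_one, h]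
  · rintro ⟨α, β⟩ -
    simp [refl_refl]
  · rintro ⟨α, β⟩ -
    simp [refl_refl]
  · rintro ⟨α, β⟩ h
    obtain ⟨hα, hβ, h⟩ := mem_rotationPairs.1 h
    dsimp only at hα hβ h ⊢
    rw [refl_refl, hk β hβ α hα]
    -- The vectors `s_β α` and `α` differ by a multiple of `β`, which an alternating form does not
    -- see.
    have h1 : ω β (refl β α) = -ω α β := by
      rw [refl_apply, map_sub, map_smul, hω, smul_zero, sub_zero, alternating_swap hω]
    rw [h1]
    by_cases hl : X α ∈ periodLattice τ
    · obtain ⟨n, hn⟩ := hR.integral α hα β hβ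
      obtain ⟨m, hm⟩ := hR.integral β hβ α hα
      have h2 : coroot (refl β α) = coroot α - (n : ℝ) • coroot β := by
        rw [coroot_map, refl_apply', ← hn, real_inner_comm]
      have h3 : X (refl α β) = X β + ((-n : ℤ) : ℂ) * X α := by
        rw [refl_apply, hn, map_sub, map_smul]
        push_cast
        rw [Complex.real_smul]
        push_cast
        ring
      have h4 : M (coroot (refl β α)) = M (coroot α) + ((-n : ℤ) : ℂ) * M (coroot β) := by
        rw [h2, map_sub, map_smul, Complex.real_smul]
        push_cast
        ring
      -- With `n = (α^∨, β)`, the shift of the argument `X β` by `-n X α ∈ Λ` and the shift of the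
      -- parameter `M (α^∨)` by `-n M (β^∨)` produce the same factor, since `latChar` lets an
      -- integer pass between parameter and argument.
      rw [sigmaRes_of_mem hl, sigmaRes_of_mem hl, h3, h4, latChar_add_left, ← latChar_int_mul,
        ellSigma_add_lattice hτ _ (int_mul_mem_periodLattice _ hl)]
      ring
    · rw [sigmaRes_of_notMem hl, sigmaRes_of_notMem hl]
      ring

theorem exp_ne_of_notMem_periodLattice {κ : ℂ} (h : κ ∉ periodLattice τ) (n : ℤ) :
    exp (2 * Real.pi * I * κ) ≠ exp (2 * Real.pi * I * n * τ) := by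
  intro h'
  obtain ⟨m, hm⟩ := exp_eq_exp_iff_exists_int.1 h'
  have : (2 * Real.pi * I : ℂ) * (κ - n * τ - m) = 0 := by linear_combination hm
  rcases mul_eq_zero.1 this with h2 | h2
  · exact absurd h2 two_pi_I_ne_zero
  · exact h ⟨m, n, by linear_combination h2⟩

/-- The functional equations when the poles along the line `X + t P` are simple and the factor of
automorphy along this line is nontrivial. -/
theorem sum_pairTerm_eq_zero_of_line (hR : IsReducedRootSystem R) (hτ : 0 < τ.im)
    (hk : ∀ α ∈ R, ∀ β ∈ R, k (refl α β) = k β) {ω : V →ₗ[ℝ] V →ₗ[ℝ] ℂ} (hω : ∀ v, ω v v = 0)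
    {M X P : V →ₗ[ℝ] ℂ} (hX : ∀ α ∈ R, X α ∉ periodLattice τ)
    (hM : ∀ α ∈ R, M (coroot α) ∉ periodLattice τ) (hP : ∀ α ∈ R, ∃ n : ℤ, P α = n)
    {κ : ℂ} (hκ : κ ∉ periodLattice τ)
    (hκP : ∀ p ∈ rotationPairs R r,
      P p.1 * M (coroot p.1) + P (refl p.1 p.2) * M (coroot p.2) = κ)
    (hdet : ∀ p ∈ rotationPairs R r,
      X p.1 * P (refl p.1 p.2) - X (refl p.1 p.2) * P p.1 ∉ periodLattice τ) :
    ∑ p ∈ rotationPairs R r, ω p.1 p.2 * pairTerm τ k M X p.1 p.2 = 0 := by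
  have hmem : ∀ p ∈ rotationPairs R r, p.1 ∈ R ∧ p.2 ∈ R ∧ refl p.1 p.2 ∈ R := fun p hp => by
    obtain ⟨h1, h2, -⟩ := mem_rotationPairs.1 hp
    exact ⟨h1, h2, hR.refl_mem _ h1 _ h2⟩
  have hshift : ∀ α ∈ R, ∀ l ∈ periodLattice τ, ∀ (μ t : ℂ),
      ellSigma τ μ (X α + (t + l) * P α) =
        latChar τ (P α * μ) l * ellSigma τ μ (X α + t * P α) := by
    intro α hα l hl μ t
    obtain ⟨n, hn⟩ := hP α hα
    rw [hn, ← latChar_int_mul, ← ellSigma_add_lattice hτ _ (int_mul_mem_periodLattice n hl)]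
    ring_nf
  set f : ℂ → ℂ := fun t => ∑ p ∈ rotationPairs R r, ω p.1 p.2 * (k p.1 * k p.2) *
    (ellSigma τ (M (coroot p.1)) (X p.1 + t * P p.1) *
      ellSigma τ (M (coroot p.2)) (X (refl p.1 p.2) + t * P (refl p.1 p.2))) with hf
  have hfl : ∀ l ∈ periodLattice τ, ∀ t, f (t + l) = latChar τ κ l * f t := by
    intro l hl t
    simp only [hf, Finset.mul_sum]
    refine Finset.sum_congr rfl fun p hp => ?_
    obtain ⟨h1, h2, h3⟩ := hmem p hp
    rw [hshift _ h1 l hl, hshift _ h3 l hl, ← hκP p hp, latChar_add_left]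
    ring
  obtain ⟨C, n, hC, hfC⟩ := liouville_quasiperiodic hτ (f := f)
    (exp_ne_zero (2 * Real.pi * I * κ))
    (fun t => MeromorphicAt.fun_sum fun p _ => (MeromorphicAt.const _ _).mul
      ((meromorphicAt_ellSigma hτ _ _ _ _).mul (meromorphicAt_ellSigma hτ _ _ _ _)))
    (fun t₀ => by
      have hsum := tendsto_finsetSum (rotationPairs R r) fun p hp => by
        obtain ⟨h1, h2, h3⟩ := hmem p hp
        exact (tendsto_mul_ellSigma_mul_ellSigma hτ (hM _ h1) (hM _ h2) (X p.1) (P p.1)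
          (X (refl p.1 p.2)) (P (refl p.1 p.2)) t₀ (fun _ => hX _ h1) (fun _ => hX _ h3)
          (fun ha hc => by
            obtain ⟨m, hm⟩ := hP _ h1
            obtain ⟨n, hn⟩ := hP _ h3
            -- If both factors had a pole at `t₀`, eliminating `t₀` with the integers `P α` and `P
            -- (s_α β)` would put the determinant in the lattice.
            apply hdet p hp
            have := sub_mem_periodLattice (int_mul_mem_periodLattice n ha)
              (int_mul_mem_periodLattice m hc)
            rw [← hm, ← hn] at this
            convert this using 1
            ring)).const_mul (ω p.1 p.2 * (k p.1 * k p.2))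
      have hres := sum_residues_eq_zero (r := r) hR hτ hk hω M (X + t₀ • P) P
      simp only [LinearMap.add_apply, LinearMap.smul_apply, smul_eq_mul] at hres
      rw [hres] at hsum
      refine hsum.congr fun t => ?_
      rw [hf, Finset.mul_sum]
      exact Finset.sum_congr rfl fun p _ => by ring)
    (fun t => by rw [hfl 1 one_mem_periodLattice, latChar_one, one_mul])
    (fun t => by rw [hfl τ self_mem_periodLattice, latChar_tau hτ])
  have hcont : ContinuousAt f 0 := by
    refine tendsto_finsetSum _ fun p hp => ?_
    obtain ⟨h1, h2, h3⟩ := hmem p hp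
    exact ((continuousAt_ellSigma_line hτ (hM _ h1) (by simpa using hX _ h1)).mul
      (continuousAt_ellSigma_line hτ (hM _ h2) (by simpa using hX _ h3))).const_mul _
  have h0 := hfC 0 hcont
  have hC0 : C = 0 := by
    by_contra h
    exact exp_ne_of_notMem_periodLattice hκ n (hC h)
  rw [hC0, zero_mul] at h0
  rw [← h0]
  refine Finset.sum_congr rfl fun p _ => ?_
  simp only [pairTerm, zero_mul, add_zero]
  ring

/-- The linear form `(q, ·)` with values in `ℂ`. -/
noncomputable def innerC (q : V) : V →ₗ[ℝ] ℂ := ofRealCLM.toLinearMap ∘ₗ innerₗ V q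

theorem innerC_apply (q x : V) : innerC q x = (⟪q, x⟫_ℝ : ℂ) := rfl

theorem eq_smul_of_smul_eq {a b : ℝ} {u v : V} (h : a • u = b • v) (hb : b ≠ 0) :
    v = (a / b) • u := by
  rw [div_eq_inv_mul, mul_smul, h, smul_smul, inv_mul_cancel₀ hb, one_smul]

/-- The assumptions of `sum_pairTerm_eq_zero_of_line` on `κ` and on the determinants hold after an
arbitrarily small perturbation of `M` and `X`, and the sum is continuous in the perturbation. -/
theorem sum_pairTerm_eq_zero (hR : IsReducedRootSystem R) (hτ : 0 < τ.im)
    (hk : ∀ α ∈ R, ∀ β ∈ R, k (refl α β) = k β) {ω : V →ₗ[ℝ] V →ₗ[ℝ] ℂ} (hω : ∀ v, ω v v = 0)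
    {M X : V →ₗ[ℝ] ℂ} (hX : ∀ α ∈ R, X α ∉ periodLattice τ)
    (hM : ∀ α ∈ R, M (coroot α) ∉ periodLattice τ) (r : V ≃ₗᵢ[ℝ] V) :
    ∑ p ∈ rotationPairs R r, ω p.1 p.2 * pairTerm τ k M X p.1 p.2 = 0 := by
  have hmem : ∀ p ∈ rotationPairs R r, p.1 ∈ R ∧ p.2 ∈ R ∧ refl p.1 p.2 ∈ R := fun p hp => by
    obtain ⟨h1, h2, -⟩ := mem_rotationPairs.1 hp
    exact ⟨h1, h2, hR.refl_mem _ h1 _ h2⟩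
  by_cases hr : r = 1
  · refine Finset.sum_eq_zero fun p hp => ?_
    obtain ⟨-, -, h⟩ := mem_rotationPairs.1 hp
    have h1 : refl p.1 p.2 = -p.2 := by
      rw [hr, mul_eq_one_iff_eq_inv, refl_inv] at h
      rw [h, refl_self]
    rw [refl_apply, sub_eq_iff_eq_add, neg_add_eq_sub, eq_sub_iff_add_eq, ← two_smul ℝ] at h1
    rw [eq_smul_of_smul_eq h1.symm two_ne_zero, map_smul, hω, smul_zero, zero_mul]
  -- A coroot serves as direction of the line because it pairs integrally with the roots; being
  -- moved by `r⁻¹`, it gives `v ≠ 0`, which allows `(v, λ)` to be perturbed off the lattice.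
  obtain ⟨δ, hδ, hδr⟩ := hR.exists_coroot_ne (r := r⁻¹) (inv_ne_one.2 hr)
  set p₀ := coroot δ with hp₀
  set v := p₀ - r⁻¹ p₀ with hv
  have hv0 : v ≠ 0 := sub_ne_zero.2 hδr.symm
  -- If this vector vanished, either both coefficients would be zero, so `v = 0`, or `α` and `s_α β`
  -- would be proportional, so `r = s_{s_α β} s_α = 1`.
  have hind : ∀ p ∈ rotationPairs R r,
      ⟪refl p.1 p.2, p₀⟫_ℝ • p.1 - ⟪p.1, p₀⟫_ℝ • refl p.1 p.2 ≠ 0 := by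
    intro p hp h
    obtain ⟨h1, h2, h3⟩ := hmem p hp
    have hpr := (mem_rotationPairs.1 hp).2.2
    have hsum := inner_smul_coroot_add hpr p₀
    rw [← hv] at hsum
    have hrr : refl (refl p.1 p.2) * refl p.1 = r := by
      rw [refl_refl_eq, mul_assoc, refl_mul_self, mul_one, hpr]
    rw [sub_eq_zero] at h
    by_cases hc : ⟪p.1, p₀⟫_ℝ = 0
    · rw [hc, zero_smul, smul_eq_zero] at h
      rcases h with h | h
      · rw [hc, h, zero_smul, zero_smul, add_zero] at hsum
        exact hv0 hsum.symm
      · exact hR.ne_zero h1 h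
    · have h4 := eq_smul_of_smul_eq h hc
      have h5 : ⟪refl p.1 p.2, p₀⟫_ℝ / ⟪p.1, p₀⟫_ℝ ≠ 0 := by
        intro h5
        rw [h5, zero_smul] at h4
        exact hR.ne_zero h3 h4
      rw [h4, refl_smul h5, refl_mul_self] at hrr
      exact hr hrr.symm
  -- Moving `X` in the direction `q` changes every determinant at a nonzero rate. Moving `M` in the
  -- direction `v` changes `κ` at the rate `(v, v) ≠ 0`.
  obtain ⟨q, hq⟩ := exists_inner_ne_zero _ _ hind
  have hev : ∀ᶠ ε : ℂ in 𝓝[≠] 0, ∑ p ∈ rotationPairs R r,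
      ω p.1 p.2 * pairTerm τ k (M + ε • innerC v) (X + ε • innerC q) p.1 p.2 = 0 := by
    have e1 : ∀ᶠ ε : ℂ in 𝓝[≠] 0, ∀ α ∈ R, X α + ε * innerC q α ∉ periodLattice τ :=
      (Finset.eventually_all R).2 fun α hα => eventually_affine_notMem hτ _ _ (fun _ => hX α hα) 0
    have e2 : ∀ᶠ ε : ℂ in 𝓝[≠] 0, ∀ α ∈ R,
        M (coroot α) + ε * innerC v (coroot α) ∉ periodLattice τ :=
      (Finset.eventually_all R).2 fun α hα => eventually_affine_notMem hτ _ _ (fun _ => hM α hα) 0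
    have e3 : ∀ᶠ ε : ℂ in 𝓝[≠] 0, M v + ε * innerC v v ∉ periodLattice τ :=
      eventually_affine_notMem hτ _ _ (fun h => by
        rw [innerC_apply, ofReal_eq_zero, inner_self_eq_zero] at h
        exact absurd h hv0) 0
    have e4 : ∀ᶠ ε : ℂ in 𝓝[≠] 0, ∀ p ∈ rotationPairs R r,
        (X p.1 * innerC p₀ (refl p.1 p.2) - X (refl p.1 p.2) * innerC p₀ p.1) +
          ε * innerC q (⟪refl p.1 p.2, p₀⟫_ℝ • p.1 - ⟪p.1, p₀⟫_ℝ • refl p.1 p.2)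
            ∉ periodLattice τ :=
      (Finset.eventually_all _).2 fun p hp => eventually_affine_notMem hτ _ _ (fun h => by
        rw [innerC_apply, ofReal_eq_zero] at h
        exact absurd h (hq p hp)) 0
    filter_upwards [e1, e2, e3, e4] with ε h1 h2 h3 h4
    refine sum_pairTerm_eq_zero_of_line hR hτ hk hω (P := innerC p₀) h1 h2
      (fun α hα => ?_) h3 (fun p hp => ?_) fun p hp => ?_
    · obtain ⟨n, hn⟩ := hR.integral δ hδ α hα
      exact ⟨n, by rw [innerC_apply, hn, ofReal_intCast]⟩
    · have hsum := inner_smul_coroot_add (mem_rotationPairs.1 hp).2.2 p₀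
      rw [← hv] at hsum
      have := congrArg (M + ε • innerC v) hsum
      rw [map_add, map_smul, map_smul, real_smul, real_smul] at this
      rw [innerC_apply, innerC_apply, real_inner_comm, real_inner_comm _ p₀, this]
      rfl
    · convert h4 p hp using 1
      simp only [LinearMap.add_apply, LinearMap.smul_apply, map_sub, map_smul, real_smul,
        smul_eq_mul, innerC_apply, real_inner_comm p₀]
      ring_nf
  have hcont : ContinuousAt (fun ε : ℂ => ∑ p ∈ rotationPairs R r,
      ω p.1 p.2 * pairTerm τ k (M + ε • innerC v) (X + ε • innerC q) p.1 p.2) 0 := by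
    have hσ : ∀ α ∈ R, ∀ β ∈ R, ContinuousAt (fun ε : ℂ => ellSigma τ
        ((M + ε • innerC v) (coroot α)) ((X + ε • innerC q) β)) 0 := by
      intro α hα β hβ
      refine ContinuousAt.comp (g := fun p : ℂ × ℂ => ellSigma τ p.1 p.2)
        (f := fun ε : ℂ => ((M + ε • innerC v) (coroot α), (X + ε • innerC q) β)) ?_ ?_
      · simpa using continuousAt_ellSigma hτ (hM α hα) (hX β hβ)
      · refine Continuous.continuousAt ?_
        simp only [LinearMap.add_apply, LinearMap.smul_apply]
        fun_prop
    refine tendsto_finsetSum _ fun p hp => ?_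
    obtain ⟨h1, h2, h3⟩ := hmem p hp
    exact (((hσ _ h1 _ h1).const_mul _).mul ((hσ _ h2 _ h3).const_mul _)).const_mul _
  have := tendsto_nhds_unique_of_eventuallyEq
    (hcont.tendsto.mono_left nhdsWithin_le_nhds) tendsto_const_nhds hev
  simpa using this

end Core

/-! ### Mixed second derivatives -/

section Calculus

/-- All second directional derivatives of `g` exist on `U` and are symmetric. -/
def HasSymmetricSecondDerivs (𝕜 : Type*) [NontriviallyNormedField 𝕜] [NormedAlgebra 𝕜 ℂ]
    {E : Type*} [AddCommGroup E] [Module 𝕜 E] (g : E → ℂ) (U : Set E) : Prop :=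
  ∀ x ∈ U, ∀ ξ η : E, LineDifferentiableAt 𝕜 (fun y => lineDeriv 𝕜 g y η) x ξ ∧
    lineDeriv 𝕜 (fun y => lineDeriv 𝕜 g y η) x ξ = lineDeriv 𝕜 (fun y => lineDeriv 𝕜 g y ξ) x η

theorem hasSymmetricSecondDerivs_of_contDiffOn {E : Type*} [NormedAddCommGroup E]
    [NormedSpace ℝ E] {g : E → ℂ} {U : Set E} (hU : IsOpen U) (hg : ContDiffOn ℝ 2 g U) :
    HasSymmetricSecondDerivs ℝ g U := by
  intro x hx ξ η
  have hgx : ContDiffAt ℝ 2 g x := hg.contDiffAt (hU.mem_nhds hx)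
  have hd : DifferentiableAt ℝ (fderiv ℝ g) x :=
    (hgx.fderiv_right (m := 1) (by norm_num)).differentiableAt (by norm_num)
  have hline : ∀ η ξ : E,
      HasLineDerivAt ℝ (fun y => lineDeriv ℝ g y η) (fderiv ℝ (fderiv ℝ g) x ξ η) x ξ := by
    intro η ξ
    have h1 : HasFDerivAt (fun y => fderiv ℝ g y η) ((fderiv ℝ (fderiv ℝ g) x).flip η) x := by
      simpa using hd.hasFDerivAt.clm_apply (hasFDerivAt_const η x)
    refine (h1.hasLineDerivAt ξ).congr_of_eventuallyEq ?_
    filter_upwards [hU.mem_nhds hx] with y hy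
    exact ((hg.contDiffAt (hU.mem_nhds hy)).differentiableAt (by norm_num)).lineDeriv_eq_fderiv
  refine ⟨(hline η ξ).lineDifferentiableAt, ?_⟩
  rw [(hline η ξ).lineDeriv, (hline ξ η).lineDeriv]
  exact (hgx.isSymmSndFDerivAt (by simp)).eq ξ η

/-- A quantitative form of differentiability for bounded holomorphic functions on a disc. -/
theorem dist_dslope_le {f : ℂ → ℂ} {ρ K : ℝ} (hf : DifferentiableOn ℂ f (Metric.ball 0 ρ))
    (hK : ∀ z ∈ Metric.ball (0 : ℂ) ρ, ‖f z‖ ≤ K) {h : ℂ} (hh : h ∈ Metric.ball (0 : ℂ) ρ) :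
    dist (dslope f 0 h) (deriv f 0) ≤ 2 * (2 * K / ρ) / ρ * ‖h‖ := by
  have hρ : 0 < ρ := Metric.nonempty_ball.1 ⟨h, hh⟩
  have h0 : (0 : ℂ) ∈ Metric.ball (0 : ℂ) ρ := Metric.mem_ball_self hρ
  have hmaps : Set.MapsTo f (Metric.ball 0 ρ) (Metric.closedBall (f 0) (2 * K)) := fun z hz => by
    rw [Metric.mem_closedBall, dist_eq_norm, two_mul]
    exact (norm_sub_le _ _).trans (add_le_add (hK z hz) (hK 0 h0))
  -- The Schwarz lemma is used twice: here to bound the difference quotient, and below for the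
  -- difference quotient itself, which is again holomorphic.
  have hds : ∀ z ∈ Metric.ball (0 : ℂ) ρ, ‖dslope f 0 z‖ ≤ 2 * K / ρ := fun z hz =>
    norm_dslope_le_div_of_mapsTo_ball hf hmaps hz
  have hmaps' : Set.MapsTo (dslope f 0) (Metric.ball 0 ρ)
      (Metric.closedBall (dslope f 0 0) (2 * (2 * K / ρ))) := fun z hz => by
    rw [Metric.mem_closedBall, dist_eq_norm, two_mul]
    exact (norm_sub_le _ _).trans (add_le_add (hds z hz) (hds 0 h0))
  have := dist_le_div_mul_dist_of_mapsTo_ball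
    ((differentiableOn_dslope (Metric.ball_mem_nhds 0 hρ)).2 hf) hmaps' hh
  rwa [dslope_same, dist_zero_right] at this

/-- The difference quotients of `g` in direction `η`, viewed as functions of the parameter `s` along
`ξ`, converge uniformly by the bound of `dist_dslope_le`. By Weierstrass the limit `∂_η g` is
holomorphic in `s`, and the `s`-derivatives converge too. This gives both existence and symmetry of
the mixed derivatives. -/
theorem hasSymmetricSecondDerivs_of_differentiableOn {E : Type*} [NormedAddCommGroup E]
    [NormedSpace ℂ E] {g : E → ℂ} {U : Set E} (hU : IsOpen U) (hg : DifferentiableOn ℂ g U) :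
    HasSymmetricSecondDerivs ℂ g U := by
  intro x hx ξ η
  obtain ⟨ρ, hρ, hball⟩ : ∃ ρ > 0, ∀ s ∈ Metric.ball (0 : ℂ) ρ, ∀ t ∈ Metric.ball (0 : ℂ) ρ,
      x + s • ξ + t • η ∈ U ∧ ‖g (x + s • ξ + t • η)‖ ≤ ‖g x‖ + 1 := by
    have hc : Tendsto (fun p : ℂ × ℂ => x + p.1 • ξ + p.2 • η) (𝓝 (0, 0)) (𝓝 x) := by
      have : Continuous fun p : ℂ × ℂ => x + p.1 • ξ + p.2 • η := by fun_prop
      simpa using this.tendsto (0, 0)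
    have hgc : ContinuousAt g x := (hg.differentiableAt (hU.mem_nhds hx)).continuousAt
    have h1 : ∀ᶠ y in 𝓝 x, y ∈ U ∧ ‖g y‖ ≤ ‖g x‖ + 1 :=
      (hU.eventually_mem hx).and
        ((hgc.norm.eventually_lt_const (lt_add_one _)).mono fun _ h => h.le)
    obtain ⟨ρ, hρ, h2⟩ := Metric.eventually_nhds_iff_ball.1 (hc.eventually h1)
    refine ⟨ρ, hρ, fun s hs t ht => h2 (s, t) ?_⟩
    rw [← ball_prod_same]
    exact ⟨hs, ht⟩
  have h0 : (0 : ℂ) ∈ Metric.ball (0 : ℂ) ρ := Metric.mem_ball_self hρ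
  set F : ℂ → ℂ → ℂ := fun h s => h⁻¹ * (g (x + s • ξ + h • η) - g (x + s • ξ)) with hF
  set G : ℂ → ℂ := fun s => lineDeriv ℂ g (x + s • ξ) η with hG
  have hdiffs : ∀ t ∈ Metric.ball (0 : ℂ) ρ,
      DifferentiableOn ℂ (fun s : ℂ => g (x + s • ξ + t • η)) (Metric.ball 0 ρ) := fun t ht =>
    hg.comp (f := fun s : ℂ => x + s • ξ + t • η) (by fun_prop) fun s hs => (hball s hs t ht).1
  have hdiff0 : DifferentiableOn ℂ (fun s : ℂ => g (x + s • ξ)) (Metric.ball 0 ρ) := by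
    simpa using hdiffs 0 h0
  have hFd : ∀ h ∈ Metric.ball (0 : ℂ) ρ, DifferentiableOn ℂ (F h) (Metric.ball 0 ρ) :=
    fun h hh => ((hdiffs h hh).sub hdiff0).const_mul _
  have hev : ∀ᶠ h : ℂ in 𝓝[≠] 0, h ∈ Metric.ball (0 : ℂ) ρ :=
    mem_nhdsWithin_of_mem_nhds (Metric.ball_mem_nhds 0 hρ)
  have hlim : TendstoLocallyUniformlyOn F G (𝓝[≠] 0) (Metric.ball 0 ρ) := by
    apply TendstoUniformlyOn.tendstoLocallyUniformlyOn
    rw [Metric.tendstoUniformlyOn_iff]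
    intro ε hε
    have hsmall : Tendsto (fun h : ℂ => 2 * (2 * (‖g x‖ + 1) / ρ) / ρ * ‖h‖) (𝓝[≠] 0) (𝓝 0) := by
      have : Continuous fun h : ℂ => 2 * (2 * (‖g x‖ + 1) / ρ) / ρ * ‖h‖ := by fun_prop
      simpa using (this.tendsto 0).mono_left nhdsWithin_le_nhds
    filter_upwards [hev, hsmall.eventually_lt_const hε, self_mem_nhdsWithin] with h hh hlt hne s hs
    refine lt_of_le_of_lt ?_ hlt
    have hd : DifferentiableOn ℂ (fun t : ℂ => g (x + s • ξ + t • η)) (Metric.ball 0 ρ) :=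
      hg.comp (f := fun t : ℂ => x + s • ξ + t • η) (by fun_prop) fun t ht => (hball s hs t ht).1
    have := dist_dslope_le hd (fun t ht => (hball s hs t ht).2) hh
    rw [dslope_of_ne _ hne, slope_def_field, sub_zero, zero_smul, add_zero,
      div_eq_inv_mul] at this
    rw [dist_comm]
    exact this
  have hGd := hlim.differentiableOn (hev.mono hFd) Metric.isOpen_ball
  have hG' : HasDerivAt G (deriv G 0) 0 :=
    (hGd.differentiableAt (Metric.ball_mem_nhds 0 hρ)).hasDerivAt
  have hline : HasLineDerivAt ℂ (fun y => lineDeriv ℂ g y η) (deriv G 0) x ξ := hG'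
  refine ⟨hline.lineDifferentiableAt, ?_⟩
  rw [hline.lineDeriv]
  symm
  refine HasLineDerivAt.lineDeriv (hasLineDerivAt_iff_tendsto_slope_zero.2 ?_)
  -- At `s = 0` the derivative of `F h` is the difference quotient in direction `η` of `∂_ξ g`, so
  -- its limit is `∂_η ∂_ξ g`.
  have hder := (hlim.deriv (hev.mono hFd) Metric.isOpen_ball).tendsto_at h0
  refine hder.congr' ?_
  filter_upwards [hev] with h hh
  have hN := Metric.ball_mem_nhds (0 : ℂ) hρ
  have e1 : deriv (fun s : ℂ => g (x + s • ξ + h • η)) 0 = lineDeriv ℂ g (x + h • η) ξ := by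
    rw [lineDeriv]
    congr 1
    ext s
    congr 1
    abel
  have e2 : HasDerivAt (F h) (h⁻¹ * (deriv (fun s : ℂ => g (x + s • ξ + h • η)) 0 -
      deriv (fun s : ℂ => g (x + s • ξ)) 0)) 0 :=
    ((((hdiffs h hh).differentiableAt hN).hasDerivAt).sub
      (hdiff0.differentiableAt hN).hasDerivAt).const_mul h⁻¹
  rw [Function.comp_apply, e2.deriv, e1, smul_eq_mul]
  rfl

end Calculus

/-! ### Operators of Dunkl type over a general field -/

section GeneralDunkl

variable {𝕜 : Type*} [NontriviallyNormedField 𝕜] [NormedAlgebra 𝕜 ℂ] {ι : Type*}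

/-- The operator `∂_ξ + ∑_{α ∈ s} A_α(ξ) F_α(A_α(x)) ŝ_α` for linear forms `A_α` and linear
maps `S_α`. -/
noncomputable def dunklGen {E : Type*} [AddCommGroup E] [Module 𝕜 E] (s : Finset ι)
    (A : ι → E →ₗ[𝕜] ℂ) (S : ι → E →ₗ[𝕜] E) (F : ι → ℂ → ℂ) (ξ : E) (g : E → ℂ) : E → ℂ :=
  fun x => lineDeriv 𝕜 g x ξ + ∑ α ∈ s, A α ξ * F α (A α x) * g (S α x)

variable {E : Type*} [NormedAddCommGroup E] [NormedSpace 𝕜 E] [CompleteSpace 𝕜]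
  [FiniteDimensional 𝕜 E] {s : Finset ι} {A : ι → E →ₗ[𝕜] ℂ} {S : ι → E →ₗ[𝕜] E}
  {F : ι → ℂ → ℂ} {g : E → ℂ} {U : Set E}

theorem hasLineDerivAt_dunkl_term {α : ι} {x : E}
    (hg : DifferentiableAt 𝕜 g (S α x)) (hF : DifferentiableAt ℂ (F α) (A α x)) (ξ η : E) :
    HasLineDerivAt 𝕜 (fun y => A α η * F α (A α y) * g (S α y))
      (A α η * (deriv (F α) (A α x) * A α ξ) * g (S α x) +
        A α η * F α (A α x) * lineDeriv 𝕜 g (S α x) (S α ξ)) x ξ := by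
  have hA : HasFDerivAt (fun y => A α y) (LinearMap.toContinuousLinearMap (A α)) x :=
    (LinearMap.toContinuousLinearMap (A α)).hasFDerivAt
  have hS : HasFDerivAt (fun y => S α y) (LinearMap.toContinuousLinearMap (S α)) x :=
    (LinearMap.toContinuousLinearMap (S α)).hasFDerivAt
  have h1 : HasLineDerivAt 𝕜 (fun y => F α (A α y)) (deriv (F α) (A α x) * A α ξ) x ξ := by
    have := ((hF.hasDerivAt.hasFDerivAt.restrictScalars 𝕜).comp x hA).hasLineDerivAt ξ
    simpa [mul_comm, Function.comp_def] using this
  have h2 : HasLineDerivAt 𝕜 (fun y => g (S α y)) (lineDeriv 𝕜 g (S α x) (S α ξ)) x ξ := by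
    have := (hg.hasFDerivAt.comp x hS).hasLineDerivAt ξ
    rw [hg.lineDeriv_eq_fderiv]
    exact this
  have h3 := (HasDerivAt.const_mul (A α η) h1).fun_mul h2
  simpa [HasLineDerivAt] using h3

/-- The first-order terms have two sources: differentiating `g ∘ S_α` gives the direction `S_α ξ`,
and the outer `ŝ_α` applied to `∂_η g` gives the direction `η`. -/
theorem dunklGen_dunklGen (hS : ∀ α ∈ s, ∀ x ∈ U, S α x ∈ U) (hU : IsOpen U)
    (hg : DifferentiableOn 𝕜 g U) (hg2 : HasSymmetricSecondDerivs 𝕜 g U)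
    (hF : ∀ α ∈ s, ∀ x ∈ U, DifferentiableAt ℂ (F α) (A α x)) (ξ η : E) {x : E} (hx : x ∈ U) :
    dunklGen s A S F ξ (dunklGen s A S F η g) x =
      lineDeriv 𝕜 (fun y => lineDeriv 𝕜 g y η) x ξ +
      ∑ α ∈ s, (A α η * (deriv (F α) (A α x) * A α ξ) * g (S α x) +
        F α (A α x) * (A α η * lineDeriv 𝕜 g (S α x) (S α ξ) +
          A α ξ * lineDeriv 𝕜 g (S α x) η)) +
      ∑ α ∈ s, ∑ β ∈ s,
        A α ξ * A β η * (F α (A α x) * F β (A β (S α x)) * g (S β (S α x))) := by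
  have hl : HasLineDerivAt 𝕜 (dunklGen s A S F η g)
      (lineDeriv 𝕜 (fun y => lineDeriv 𝕜 g y η) x ξ +
        ∑ α ∈ s, (A α η * (deriv (F α) (A α x) * A α ξ) * g (S α x) +
          A α η * F α (A α x) * lineDeriv 𝕜 g (S α x) (S α ξ))) x ξ :=
    HasDerivAt.fun_add ((hg2 x hx ξ η).1.hasLineDerivAt)
      (HasDerivAt.fun_sum fun α hα => hasLineDerivAt_dunkl_term
        (hg.differentiableAt (hU.mem_nhds (hS α hα x hx))) (hF α hα x hx) ξ η)
  rw [dunklGen, hl.lineDeriv, add_assoc, add_assoc, ← Finset.sum_add_distrib,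
    ← Finset.sum_add_distrib]
  congr 1
  refine Finset.sum_congr rfl fun α _ => ?_
  rw [dunklGen, mul_add, Finset.mul_sum]
  rw [Finset.sum_congr rfl fun β _ => show A α ξ * F α (A α x) *
    (A β η * F β (A β (S α x)) * g (S β (S α x))) =
      A α ξ * A β η * (F α (A α x) * F β (A β (S α x)) * g (S β (S α x))) by ring]
  ring

/-- Operators of Dunkl type commute if their terms of order zero do. -/
theorem dunklGen_comm (hS : ∀ α ∈ s, ∀ x ∈ U, S α x ∈ U) (hU : IsOpen U)
    (hg : DifferentiableOn 𝕜 g U) (hg2 : HasSymmetricSecondDerivs 𝕜 g U)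
    (hF : ∀ α ∈ s, ∀ x ∈ U, DifferentiableAt ℂ (F α) (A α x))
    (hrefl : ∀ α ∈ s, ∃ (a : E → 𝕜) (c : E), ∀ ξ, A α ξ = algebraMap 𝕜 ℂ (a ξ) ∧
      S α ξ = ξ - a ξ • c) (ξ η : E) {x : E} (hx : x ∈ U)
    (h0 : ∑ α ∈ s, ∑ β ∈ s, (A α ξ * A β η - A α η * A β ξ) *
      (F α (A α x) * F β (A β (S α x)) * g (S β (S α x))) = 0) :
    dunklGen s A S F ξ (dunklGen s A S F η g) x =
      dunklGen s A S F η (dunklGen s A S F ξ g) x := by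
  rw [dunklGen_dunklGen hS hU hg hg2 hF ξ η hx, dunklGen_dunklGen hS hU hg hg2 hF η ξ hx,
    (hg2 x hx ξ η).2]
  simp only [sub_mul, Finset.sum_sub_distrib] at h0
  rw [sub_eq_zero] at h0
  rw [h0]
  congr 2
  refine Finset.sum_congr rfl fun α hα => ?_
  -- Replacing `S_α ξ` by `ξ - a(ξ) c` makes the first-order terms symmetric in `ξ` and `η`: the
  -- correction is proportional to `a(ξ) a(η) ∂_c g`.
  obtain ⟨a, c, h⟩ := hrefl α hα
  have hd := hg.differentiableAt (hU.mem_nhds (hS α hα x hx))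
  have hsub : ∀ ζ, lineDeriv 𝕜 g (S α x) (S α ζ) = lineDeriv 𝕜 g (S α x) ζ -
      algebraMap 𝕜 ℂ (a ζ) * lineDeriv 𝕜 g (S α x) c := by
    intro ζ
    rw [(h ζ).2, hd.lineDeriv_eq_fderiv, hd.lineDeriv_eq_fderiv, hd.lineDeriv_eq_fderiv, map_sub,
      map_smul, Algebra.smul_def]
  rw [hsub, hsub, (h ξ).1, (h η).1]
  ring

end GeneralDunkl

/-! ### From all roots to positive roots -/

section Positive

variable {V : Type*} [NormedAddCommGroup V] [InnerProductSpace ℝ V] {R : Finset V}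

theorem mem_of_mem_posRoots {ℓ : V →ₗ[ℝ] ℝ} {α : V} (h : α ∈ posRoots R ℓ) : α ∈ R :=
  (Finset.mem_filter.1 h).1

theorem sum_eq_two_mul_sum_posRoots (hR : IsReducedRootSystem R) {ℓ : V →ₗ[ℝ] ℝ}
    (hℓ : ∀ α ∈ R, ℓ α ≠ 0) {φ : V → ℂ} (hφ : ∀ α ∈ R, φ (-α) = φ α) :
    ∑ α ∈ R, φ α = 2 * ∑ α ∈ posRoots R ℓ, φ α := by
  classical
  rw [← Finset.sum_filter_add_sum_filter_not R (fun α => 0 < ℓ α), two_mul]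
  congr 1
  refine Finset.sum_nbij' (fun α => -α) (fun α => -α) ?_ ?_ ?_ ?_ ?_
  · intro α h
    obtain ⟨h1, h2⟩ := Finset.mem_filter.1 h
    refine Finset.mem_filter.2 ⟨hR.neg_mem h1, ?_⟩
    rw [map_neg]
    have := lt_of_le_of_ne (not_lt.1 h2) (hℓ α h1)
    linarith
  · intro α h
    obtain ⟨h1, h2⟩ := Finset.mem_filter.1 h
    refine Finset.mem_filter.2 ⟨hR.neg_mem h1, ?_⟩
    rw [map_neg]
    linarith
  · simp
  · simp
  · intro α h
    exact (hφ α (Finset.mem_filter.1 h).1).symm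

/-- The element `w` need not preserve `R₊`, but it permutes `R`, and for even summands the sum over
`R` is twice the sum over `R₊`. -/
theorem sum_posRoots_eq_of_weylGroup (hR : IsReducedRootSystem R) {ℓ : V →ₗ[ℝ] ℝ}
    (hℓ : ∀ α ∈ R, ℓ α ≠ 0) {w : V ≃ₗᵢ[ℝ] V} (hw : w ∈ weylGroup R) {φ ψ : V → ℂ}
    (hφ : ∀ α ∈ R, φ (-α) = φ α) (hψ : ∀ α ∈ R, ψ (-α) = ψ α) (h : ∀ α ∈ R, ψ (w α) = φ α) :
    ∑ α ∈ posRoots R ℓ, φ α = ∑ α ∈ posRoots R ℓ, ψ α := by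
  have h1 : ∑ α ∈ R, φ α = ∑ α ∈ R, ψ α := by
    refine Finset.sum_nbij' (fun α => w α) (fun α => w⁻¹ α) (hR.map_mem hw)
      (hR.map_mem (inv_mem hw)) (fun α _ => w.symm_apply_apply α)
      (fun α _ => w.apply_symm_apply α) fun α hα => (h α hα).symm
  rw [sum_eq_two_mul_sum_posRoots hR hℓ hφ, sum_eq_two_mul_sum_posRoots hR hℓ hψ] at h1
  exact mul_left_cancel₀ two_ne_zero h1

theorem apply_neg_of_refl_invariant {k : V → ℂ}
    (hk : ∀ α ∈ R, ∀ β ∈ R, k (refl α β) = k β) {α : V} (hα : α ∈ R) : k (-α) = k α := by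
  rw [← refl_self, hk α hα α hα]

variable {τ : ℂ} {k : V → ℂ}

/-- The functional equations for positive roots, with an arbitrary dependence on the rotation. -/
theorem sum_posRoots_pairTerm_eq_zero (hR : IsReducedRootSystem R) {ℓ : V →ₗ[ℝ] ℝ}
    (hℓ : ∀ α ∈ R, ℓ α ≠ 0) (hτ : 0 < τ.im)
    (hk : ∀ α ∈ R, ∀ β ∈ R, k (refl α β) = k β) {ω : V →ₗ[ℝ] V →ₗ[ℝ] ℂ} (hω : ∀ v, ω v v = 0)
    {M X : V →ₗ[ℝ] ℂ} (hX : ∀ α ∈ R, X α ∉ periodLattice τ)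
    (hM : ∀ α ∈ R, M (coroot α) ∉ periodLattice τ) (G : (V ≃ₗᵢ[ℝ] V) → ℂ) :
    ∑ α ∈ posRoots R ℓ, ∑ β ∈ posRoots R ℓ,
      ω α β * pairTerm τ k M X α β * G (refl α * refl β) = 0 := by
  classical
  have h1 : ∀ α ∈ R, ∀ β, ω (-α) β * pairTerm τ k M X (-α) β * G (refl (-α) * refl β) =
      ω α β * pairTerm τ k M X α β * G (refl α * refl β) := by
    intro α hα β
    simp only [pairTerm, refl_neg, coroot_neg, map_neg, ellSigma_neg_neg, apply_neg_of_refl_invariant hk hα,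
      LinearMap.neg_apply]
    ring
  have h2 : ∀ α, ∀ β ∈ R, ω α (-β) * pairTerm τ k M X α (-β) * G (refl α * refl (-β)) =
      ω α β * pairTerm τ k M X α β * G (refl α * refl β) := by
    intro α β hβ
    simp only [pairTerm, refl_neg, coroot_neg, map_neg, ellSigma_neg_neg, apply_neg_of_refl_invariant hk hβ]
    ring
  have h3 : ∑ α ∈ R, ∑ β ∈ R, ω α β * pairTerm τ k M X α β * G (refl α * refl β) = 0 := by
    let T : V × V → ℂ := fun p => ω p.1 p.2 * pairTerm τ k M X p.1 p.2 * G (refl p.1 * refl p.2)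
    have e1 : ∑ p ∈ R ×ˢ R, T p = ∑ α ∈ R, ∑ β ∈ R, T (α, β) := Finset.sum_product R R T
    -- The pairs are grouped by the product `r` of their reflections; `G` is constant on each group
    -- and factors out.
    have e2 := Finset.sum_fiberwise_of_maps_to (s := R ×ˢ R)
      (t := (R ×ˢ R).image fun p => refl p.1 * refl p.2) (g := fun p => refl p.1 * refl p.2)
      (fun p hp => Finset.mem_image_of_mem _ hp) T
    refine (e1.symm.trans e2.symm).trans (Finset.sum_eq_zero fun r _ => ?_)
    have h := sum_pairTerm_eq_zero hR hτ hk hω hX hM r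
    rw [← mul_eq_zero_of_left h (G r), Finset.sum_mul]
    refine Finset.sum_congr (by ext; simp [rotationPairs]) fun p hp => ?_
    change ω p.1 p.2 * pairTerm τ k M X p.1 p.2 * G (refl p.1 * refl p.2) = _
    rw [(Finset.mem_filter.1 hp).2]
  rw [sum_eq_two_mul_sum_posRoots hR hℓ fun α hα => Finset.sum_congr rfl fun β _ => h1 α hα β,
    Finset.sum_congr rfl fun α _ => sum_eq_two_mul_sum_posRoots hR hℓ (h2 α),
    ← Finset.mul_sum] at h3
  simpa using h3

/-- The alternating form `a ∧ b`. -/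
noncomputable def wedge (a b : V →ₗ[ℝ] ℂ) : V →ₗ[ℝ] V →ₗ[ℝ] ℂ :=
  LinearMap.mk₂ ℝ (fun u v => a u * b v - b u * a v)
    (fun _ _ _ => by simp only [map_add]; ring)
    (fun _ _ _ => by simp only [map_smul, smul_mul_assoc, smul_sub])
    (fun _ _ _ => by simp only [map_add]; ring)
    (fun _ _ _ => by simp only [map_smul, mul_smul_comm, smul_sub])

theorem wedge_apply (a b : V →ₗ[ℝ] ℂ) (u v : V) : wedge a b u v = a u * b v - b u * a v := rfl

theorem wedge_self (a b : V →ₗ[ℝ] ℂ) (v : V) : wedge a b v v = 0 := by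
  rw [wedge_apply]
  ring

/-- The oriented area as an alternating form. -/
noncomputable def areaC [FiniteDimensional ℝ V] (E : Submodule ℝ V)
    [Fact (Module.finrank ℝ E = 2)] (o : Orientation ℝ E (Fin 2)) : V →ₗ[ℝ] V →ₗ[ℝ] ℂ :=
  LinearMap.mk₂ ℝ (fun u v => (orientedArea E o u v : ℂ))
    (fun _ _ _ => by simp [orientedArea])
    (fun _ _ _ => by simp [orientedArea])
    (fun _ _ _ => by simp [orientedArea])
    (fun _ _ _ => by simp [orientedArea])

theorem areaC_apply [FiniteDimensional ℝ V] (E : Submodule ℝ V)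
    [Fact (Module.finrank ℝ E = 2)] (o : Orientation ℝ E (Fin 2)) (u v : V) :
    areaC E o u v = (orientedArea E o u v : ℂ) := rfl

theorem areaC_self [FiniteDimensional ℝ V] (E : Submodule ℝ V)
    [Fact (Module.finrank ℝ E = 2)] (o : Orientation ℝ E (Fin 2)) (v : V) :
    areaC E o v v = 0 := by
  simp [areaC_apply, orientedArea]

end Positive

/-! ### The complexification -/

section Complexification

variable {V : Type*} [NormedAddCommGroup V] [InnerProductSpace ℝ V]

/-- The linear form `α ↦ (α, x)` on `V` for `x ∈ V_ℂ`. -/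
noncomputable def pairForm (x : ℂ ⊗[ℝ] V) : V →ₗ[ℝ] ℂ where
  toFun α := pairC α x
  map_add' α β := by simp [pairC, TensorProduct.tmul_add]
  map_smul' c α := by
    induction x with
    | zero => simp
    | tmul z v => simp [pairC_tmul, real_inner_smul_left]; ring
    | add x y hx hy => simp only [map_add, hx, hy, smul_add]

theorem pairForm_apply (x : ℂ ⊗[ℝ] V) (α : V) : pairForm x α = pairC α x := rfl

theorem pairC_complexify (w : V ≃ₗᵢ[ℝ] V) (α : V) (x : ℂ ⊗[ℝ] V) :
    pairC (w α) (complexify w x) = pairC α x := by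
  induction x with
  | zero => simp
  | tmul z v => rw [complexify_tmul, pairC_tmul, pairC_tmul, w.inner_map_map]
  | add x y hx hy => simp only [map_add, hx, hy]

theorem complexify_mul (v w : V ≃ₗᵢ[ℝ] V) (x : ℂ ⊗[ℝ] V) :
    complexify (v * w) x = complexify v (complexify w x) := by
  induction x with
  | zero => simp
  | tmul z u => simp only [complexify_tmul, isometry_mul_apply]
  | add x y hx hy => simp only [map_add, hx, hy]

theorem complexify_one (x : ℂ ⊗[ℝ] V) : complexify (1 : V ≃ₗᵢ[ℝ] V) x = x := by
  induction x with
  | zero => simp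
  | tmul z u => rw [complexify_tmul]; rfl
  | add x y hx hy => simp only [map_add, hx, hy]

theorem pairC_complexify_refl (α β : V) (x : ℂ ⊗[ℝ] V) :
    pairC β (complexify (refl α) x) = pairC (refl α β) x := by
  rw [← pairC_complexify (refl α) (refl α β), refl_refl]

theorem complexify_refl_apply (α : V) (x : ℂ ⊗[ℝ] V) :
    complexify (refl α) x = x - pairC α x • ((1 : ℂ) ⊗ₜ[ℝ] coroot α) := by
  induction x with
  | zero => simp
  | tmul z v =>
    rw [complexify_tmul, refl_apply', TensorProduct.tmul_sub, pairC_tmul, TensorProduct.smul_tmul',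
      smul_eq_mul, mul_one, ← TensorProduct.smul_tmul, real_smul, mul_comm]
  | add x y hx hy =>
    rw [map_add, map_add, hx, hy, add_smul]
    abel

end Complexification

/-! ### The elliptic Dunkl operators -/

section Main

variable {V : Type*} [NormedAddCommGroup V] [InnerProductSpace ℝ V] {R : Finset V}
  {ℓ : V →ₗ[ℝ] ℝ} {τ : ℂ} {k : V → ℂ} {lam : ℂ ⊗[ℝ] V}

theorem ellFun_neg_neg (hk : ∀ α ∈ R, ∀ β ∈ R, k (refl α β) = k β) {α : V} (hα : α ∈ R) (z : ℂ) :
    ellFun τ k lam (-α) (-z) = -ellFun τ k lam α z := by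
  have h : pairC (-coroot α) lam = -pairC (coroot α) lam := map_neg (pairForm lam) _
  rw [ellFun, ellFun, apply_neg_of_refl_invariant hk hα, coroot_neg, h, ellSigma_neg_neg, mul_neg]

theorem ellFun_map {w : V ≃ₗᵢ[ℝ] V} (hw : ∀ α ∈ R, k (w α) = k α) {α : V} (hα : α ∈ R) (z : ℂ) :
    ellFun τ k (complexify w lam) (w α) z = ellFun τ k lam α z := by
  rw [ellFun, ellFun, hw α hα, coroot_map, pairC_complexify]

theorem differentiableAt_ellFun (hτ : 0 < τ.im) (hlam : IsGeneric R τ lam) {α : V} (hα : α ∈ R)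
    {z : ℂ} (hz : z ∉ periodLattice τ) : DifferentiableAt ℂ (ellFun τ k lam α) z :=
  (differentiableAt_ellSigma hτ (hlam α hα) hz).const_mul (k α)

theorem functionalEquations_ellFun [FiniteDimensional ℝ V] (hR : IsReducedRootSystem R)
    (hℓ : ∀ α ∈ R, ℓ α ≠ 0) (hτ : 0 < τ.im) (hk : ∀ α ∈ R, ∀ β ∈ R, k (refl α β) = k β)
    (hlam : IsGeneric R τ lam) :
    FunctionalEquations (posRoots R ℓ) (ellFun τ k lam) (regularSetC R τ) := by
  classical
  intro r E _ o _ x hx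
  -- The weight `G` is the indicator of `r` and selects a single functional equation.
  have h := sum_posRoots_pairTerm_eq_zero hR hℓ hτ hk (areaC_self E o) (M := pairForm lam)
    (X := pairForm x) hx hlam (fun r' => if r' = r then 1 else 0)
  rw [Finset.sum_filter, Finset.sum_product]
  refine (Finset.sum_congr rfl fun α _ => Finset.sum_congr rfl fun β _ => ?_).trans h
  by_cases hr : refl α * refl β = r
  · simp only [hr, if_true, areaC_apply, pairTerm, pairForm_apply, ellFun]
    ring
  · simp only [hr, if_false, mul_zero]

/-! #### Functions on `V` -/

theorem ellDunkl_eq (ξ : V) (g : V → ℂ) : ellDunkl (posRoots R ℓ) τ k lam ξ g =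
    dunklGen (𝕜 := ℝ) (posRoots R ℓ) innerC (fun α => ((refl α).toLinearEquiv : V →ₗ[ℝ] V))
      (ellFun τ k lam) ξ g := rfl

theorem ellDunkl_comm [FiniteDimensional ℝ V] (hR : IsReducedRootSystem R)
    (hℓ : ∀ α ∈ R, ℓ α ≠ 0) (hτ : 0 < τ.im) (hk : ∀ α ∈ R, ∀ β ∈ R, k (refl α β) = k β)
    (hlam : IsGeneric R τ lam) {U : Set V} (hU : IsOpen U) (hreg : U ⊆ regularSet R τ)
    (hS : ∀ α ∈ R, ∀ x ∈ U, refl α x ∈ U) {g : V → ℂ} (hg : ContDiffOn ℝ 2 g U) (ξ η : V) {x : V}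
    (hx : x ∈ U) :
    ellDunkl (posRoots R ℓ) τ k lam ξ (ellDunkl (posRoots R ℓ) τ k lam η g) x =
      ellDunkl (posRoots R ℓ) τ k lam η (ellDunkl (posRoots R ℓ) τ k lam ξ g) x := by
  simp only [ellDunkl_eq]
  refine dunklGen_comm (U := U) (fun α hα => hS α (mem_of_mem_posRoots hα)) hU
    (hg.differentiableOn (by norm_num)) (hasSymmetricSecondDerivs_of_contDiffOn hU hg)
    (fun α hα y hy => differentiableAt_ellFun hτ hlam (mem_of_mem_posRoots hα)
      (hreg hy α (mem_of_mem_posRoots hα)))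
    (fun α _ => ⟨fun ζ => ⟪α, ζ⟫_ℝ, coroot α, fun ζ => ⟨rfl, refl_apply' α ζ⟩⟩) ξ η hx ?_
  -- Antisymmetrizing `(α, ξ)(β, η)` in `ξ, η` gives `ξ ∧ η` at `(α, β)`, and `g (s_β s_α x)`
  -- depends only on `r = s_α s_β`.
  have h := sum_posRoots_pairTerm_eq_zero hR hℓ hτ hk (wedge_self (innerC ξ) (innerC η))
    (M := pairForm lam) (X := innerC x)
    (fun α hα => by rw [innerC_apply, real_inner_comm]; exact hreg hx α hα) hlam
    (fun r => g (r⁻¹ x))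
  rw [← h]
  refine Finset.sum_congr rfl fun α _ => Finset.sum_congr rfl fun β _ => ?_
  have e1 : (refl α * refl β)⁻¹ x = refl β (refl α x) := by
    rw [mul_inv_rev, refl_inv, refl_inv]
    rfl
  have e2 : ⟪β, refl α x⟫_ℝ = ⟪x, refl α β⟫_ℝ := by rw [← inner_refl, real_inner_comm]
  rw [e1]
  simp only [wedge_apply, pairTerm, pairForm_apply, ellFun, innerC_apply,
    LinearEquiv.coe_coe, LinearIsometryEquiv.coe_toLinearEquiv, e2, real_inner_comm α,
    real_inner_comm β]
  ring

theorem ellDunkl_equivariant (hR : IsReducedRootSystem R)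
    (hℓ : ∀ α ∈ R, ℓ α ≠ 0) (hk : ∀ w ∈ weylGroup R, ∀ α ∈ R, k (w α) = k α)
    {w : V ≃ₗᵢ[ℝ] V} (hw : w ∈ weylGroup R) (g : V → ℂ) (ξ x : V) :
    hat w (ellDunkl (posRoots R ℓ) τ k lam ξ (hat w⁻¹ g)) x =
      ellDunkl (posRoots R ℓ) τ k (complexify w lam) (w ξ) g x := by
  have hk' : ∀ α ∈ R, ∀ β ∈ R, k (refl α β) = k β := fun α hα =>
    hk _ (refl_mem_weylGroup hα)
  have hwx : w (w⁻¹ x) = x := w.apply_symm_apply x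
  have hsum := sum_posRoots_eq_of_weylGroup hR hℓ hw
    (φ := fun α => (⟪α, ξ⟫_ℝ : ℂ) * ellFun τ k lam α (⟪α, w⁻¹ x⟫_ℝ : ℂ) *
      g (w (refl α (w⁻¹ x))))
    (ψ := fun α => (⟪α, w ξ⟫_ℝ : ℂ) * ellFun τ k (complexify w lam) α (⟪α, x⟫_ℝ : ℂ) *
      g (refl α x))
    (fun α hα => by simp only [inner_neg_left, ofReal_neg, ellFun_neg_neg hk' hα, refl_neg]; ring)
    (fun α hα => by simp only [inner_neg_left, ofReal_neg, ellFun_neg_neg hk' hα, refl_neg]; ring)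
    (fun α hα => by
      have e : ⟪w α, x⟫_ℝ = ⟪α, w⁻¹ x⟫_ℝ := by rw [← w.inner_map_map α, hwx]
      simp only [w.inner_map_map, e, ellFun_map (hk w hw) hα, refl_map, isometry_mul_apply])
  -- A linear map carries the line through `w⁻¹ x` in direction `ξ` to the line through `x` in
  -- direction `w ξ`, so both derivatives are of the same function of one variable.
  have hderiv : lineDeriv ℝ (hat w⁻¹ g) (w⁻¹ x) ξ = lineDeriv ℝ g x (w ξ) := by
    simp only [lineDeriv, hat, inv_inv, map_add, map_smul, hwx]
  have hh : ∀ y, hat w⁻¹ g y = g (w y) := fun y => by rw [hat, inv_inv]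
  rw [hat, ellDunkl, ellDunkl, dunkl, dunkl, hderiv, ← hsum]
  simp only [hh]

/-! #### Functions on `V_ℂ` -/

/-- Pulling back by a linear coordinate system turns the operators on `V_ℂ` into `dunklGen` on the
normed space `Fin n → ℂ`, where the general commutation criterion applies. -/
theorem ellDunklC_comp (ξ : ℂ ⊗[ℝ] V) (g : (ℂ ⊗[ℝ] V) → ℂ) {n : ℕ}
    (e : (Fin n → ℂ) ≃ₗ[ℂ] (ℂ ⊗[ℝ] V)) :
    ellDunklC (posRoots R ℓ) τ k lam ξ g ∘ e =
      dunklGen (𝕜 := ℂ) (posRoots R ℓ) (fun α => pairC α ∘ₗ (e : (Fin n → ℂ) →ₗ[ℂ] (ℂ ⊗[ℝ] V)))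
        (fun α => (e.symm : (ℂ ⊗[ℝ] V) →ₗ[ℂ] (Fin n → ℂ)) ∘ₗ complexify (refl α) ∘ₗ
          (e : (Fin n → ℂ) →ₗ[ℂ] (ℂ ⊗[ℝ] V)))
        (ellFun τ k lam) (e.symm ξ) (g ∘ e) := by
  ext y
  simp [ellDunklC, dunklC, dunklGen, lineDeriv]

theorem ellDunklC_comm [FiniteDimensional ℝ V] (hR : IsReducedRootSystem R)
    (hℓ : ∀ α ∈ R, ℓ α ≠ 0) (hτ : 0 < τ.im) (hk : ∀ α ∈ R, ∀ β ∈ R, k (refl α β) = k β)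
    (hlam : IsGeneric R τ lam) {U : Set (ℂ ⊗[ℝ] V)} (hU : IsOpenC U)
    (hreg : U ⊆ regularSetC R τ) (hS : ∀ α ∈ R, ∀ x ∈ U, complexify (refl α) x ∈ U)
    {g : (ℂ ⊗[ℝ] V) → ℂ} (hg : IsHolomorphicOn g U) (ξ η : ℂ ⊗[ℝ] V) {x : ℂ ⊗[ℝ] V}
    (hx : x ∈ U) :
    ellDunklC (posRoots R ℓ) τ k lam ξ (ellDunklC (posRoots R ℓ) τ k lam η g) x =
      ellDunklC (posRoots R ℓ) τ k lam η (ellDunklC (posRoots R ℓ) τ k lam ξ g) x := by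
  set e := (Module.finBasis ℂ (ℂ ⊗[ℝ] V)).equivFun.symm with he
  clear_value e
  have hU' := hU _ e
  have hg' := hg _ e
  obtain ⟨y, rfl⟩ := e.surjective x
  change (ellDunklC (posRoots R ℓ) τ k lam ξ (ellDunklC (posRoots R ℓ) τ k lam η g) ∘ e) y =
    (ellDunklC (posRoots R ℓ) τ k lam η (ellDunklC (posRoots R ℓ) τ k lam ξ g) ∘ e) y
  simp only [ellDunklC_comp]
  refine dunklGen_comm (U := e ⁻¹' U) (fun α hα z hz => ?_) hU' hg'
    (hasSymmetricSecondDerivs_of_differentiableOn hU' hg')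
    (fun α hα z hz => differentiableAt_ellFun hτ hlam (mem_of_mem_posRoots hα)
      (hreg hz α (mem_of_mem_posRoots hα)))
    (fun α _ => ⟨fun ζ => pairC α (e ζ), e.symm ((1 : ℂ) ⊗ₜ[ℝ] coroot α), fun ζ => ⟨rfl, ?_⟩⟩)
    _ _ hx ?_
  · simpa using hS α (mem_of_mem_posRoots hα) (e z) hz
  · simp [complexify_refl_apply]
  -- For complex `ξ` and `η` the form `ξ ∧ η` is a complex-valued alternating form on the real space
  -- `V`, which the functional equations allow.
  have h := sum_posRoots_pairTerm_eq_zero hR hℓ hτ hk (wedge_self (pairForm ξ) (pairForm η))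
    (M := pairForm lam) (X := pairForm (e y)) (hreg hx) hlam
    (fun r => g (complexify r⁻¹ (e y)))
  rw [← h]
  refine Finset.sum_congr rfl fun α _ => Finset.sum_congr rfl fun β _ => ?_
  have e1 : complexify (refl α * refl β)⁻¹ (e y) =
      complexify (refl β) (complexify (refl α) (e y)) := by
    rw [mul_inv_rev, refl_inv, refl_inv, complexify_mul]
  rw [e1]
  simp only [wedge_apply, pairTerm, pairForm_apply, ellFun, LinearMap.comp_apply,
    LinearEquiv.coe_coe, LinearEquiv.apply_symm_apply, Function.comp_apply, pairC_complexify_refl]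
  ring

theorem ellDunklC_equivariant (hR : IsReducedRootSystem R)
    (hℓ : ∀ α ∈ R, ℓ α ≠ 0) (hk : ∀ w ∈ weylGroup R, ∀ α ∈ R, k (w α) = k α)
    {w : V ≃ₗᵢ[ℝ] V} (hw : w ∈ weylGroup R) (g : (ℂ ⊗[ℝ] V) → ℂ) (ξ x : ℂ ⊗[ℝ] V) :
    hatC w (ellDunklC (posRoots R ℓ) τ k lam ξ (hatC w⁻¹ g)) x =
      ellDunklC (posRoots R ℓ) τ k (complexify w lam) (complexify w ξ) g x := by
  have hk' : ∀ α ∈ R, ∀ β ∈ R, k (refl α β) = k β := fun α hα =>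
    hk _ (refl_mem_weylGroup hα)
  have hwx : complexify w (complexify w⁻¹ x) = x := by
    rw [← complexify_mul, mul_inv_cancel, complexify_one]
  have hneg : ∀ α (y : ℂ ⊗[ℝ] V), pairC (-α) y = -pairC α y := fun α y => map_neg (pairForm y) α
  have hsum := sum_posRoots_eq_of_weylGroup hR hℓ hw
    (φ := fun α => pairC α ξ * ellFun τ k lam α (pairC α (complexify w⁻¹ x)) *
      g (complexify w (complexify (refl α) (complexify w⁻¹ x))))
    (ψ := fun α => pairC α (complexify w ξ) * ellFun τ k (complexify w lam) α (pairC α x) *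
      g (complexify (refl α) x))
    (fun α hα => by simp only [hneg, ellFun_neg_neg hk' hα, refl_neg]; ring)
    (fun α hα => by simp only [hneg, ellFun_neg_neg hk' hα, refl_neg]; ring)
    (fun α hα => by
      have e : pairC (w α) x = pairC α (complexify w⁻¹ x) := by rw [← pairC_complexify w α, hwx]
      simp only [pairC_complexify, e, ellFun_map (hk w hw) hα, refl_map, complexify_mul])
  have hderiv : lineDeriv ℂ (hatC w⁻¹ g) (complexify w⁻¹ x) ξ =
      lineDeriv ℂ g x (complexify w ξ) := by
    simp only [lineDeriv, hatC, inv_inv, map_add, map_smul, hwx]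
  have hh : ∀ y, hatC w⁻¹ g y = g (complexify w y) := fun y => by rw [hatC, inv_inv]
  rw [hatC, ellDunklC, ellDunklC, dunklC, dunklC, hderiv, ← hsum]
  simp only [hh]

end Main

end EllipticDunkl

theorem mainTheorem1 {V : Type*} [NormedAddCommGroup V] [InnerProductSpace ℝ V]
    [FiniteDimensional ℝ V] (R : Finset V) (hR : EllipticDunkl.IsReducedRootSystem R)
    (ℓ : V →ₗ[ℝ] ℝ) (hℓ : ∀ α ∈ R, ℓ α ≠ 0)
    (τ : ℂ) (hτ : 0 < τ.im)
    (k : V → ℂ) (hk : ∀ w ∈ EllipticDunkl.weylGroup R, ∀ α ∈ R, k (w α) = k α)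
    (lam : ℂ ⊗[ℝ] V) (hlam : EllipticDunkl.IsGeneric R τ lam) :
    -- the functional equations
    EllipticDunkl.FunctionalEquations (EllipticDunkl.posRoots R ℓ)
      (EllipticDunkl.ellFun τ k lam) (EllipticDunkl.regularSetC R τ) ∧
    -- commutativity and equivariance on functions on `V`
    (∀ U : Set V, IsOpen U → U ⊆ EllipticDunkl.regularSet R τ →
      (∀ w ∈ EllipticDunkl.weylGroup R, ∀ x ∈ U, w x ∈ U) →
      (∀ g : V → ℂ, ContDiffOn ℝ 2 g U → ∀ ξ η : V, ∀ x ∈ U,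
        EllipticDunkl.ellDunkl (EllipticDunkl.posRoots R ℓ) τ k lam ξ
            (EllipticDunkl.ellDunkl (EllipticDunkl.posRoots R ℓ) τ k lam η g) x =
          EllipticDunkl.ellDunkl (EllipticDunkl.posRoots R ℓ) τ k lam η
            (EllipticDunkl.ellDunkl (EllipticDunkl.posRoots R ℓ) τ k lam ξ g) x) ∧
      (∀ g : V → ℂ, DifferentiableOn ℝ g U → ∀ w ∈ EllipticDunkl.weylGroup R, ∀ ξ : V, ∀ x ∈ U,
        EllipticDunkl.hat w (EllipticDunkl.ellDunkl (EllipticDunkl.posRoots R ℓ) τ k lam ξ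
            (EllipticDunkl.hat w⁻¹ g)) x =
          EllipticDunkl.ellDunkl (EllipticDunkl.posRoots R ℓ) τ k
            (EllipticDunkl.complexify w lam) (w ξ) g x)) ∧
    -- commutativity and equivariance on holomorphic functions on `V_ℂ`
    (∀ U : Set (ℂ ⊗[ℝ] V), EllipticDunkl.IsOpenC U → U ⊆ EllipticDunkl.regularSetC R τ →
      (∀ w ∈ EllipticDunkl.weylGroup R, ∀ x ∈ U, EllipticDunkl.complexify w x ∈ U) →
      ∀ g : (ℂ ⊗[ℝ] V) → ℂ, EllipticDunkl.IsHolomorphicOn g U →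
      (∀ ξ η : ℂ ⊗[ℝ] V, ∀ x ∈ U,
        EllipticDunkl.ellDunklC (EllipticDunkl.posRoots R ℓ) τ k lam ξ
            (EllipticDunkl.ellDunklC (EllipticDunkl.posRoots R ℓ) τ k lam η g) x =
          EllipticDunkl.ellDunklC (EllipticDunkl.posRoots R ℓ) τ k lam η
            (EllipticDunkl.ellDunklC (EllipticDunkl.posRoots R ℓ) τ k lam ξ g) x) ∧
      (∀ w ∈ EllipticDunkl.weylGroup R, ∀ ξ : ℂ ⊗[ℝ] V, ∀ x ∈ U,
        EllipticDunkl.hatC w (EllipticDunkl.ellDunklC (EllipticDunkl.posRoots R ℓ) τ k lam ξ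
            (EllipticDunkl.hatC w⁻¹ g)) x =
          EllipticDunkl.ellDunklC (EllipticDunkl.posRoots R ℓ) τ k
            (EllipticDunkl.complexify w lam) (EllipticDunkl.complexify w ξ) g x)) := by
  have hk' : ∀ α ∈ R, ∀ β ∈ R, k (EllipticDunkl.refl α β) = k β := fun α hα =>
    hk _ (EllipticDunkl.refl_mem_weylGroup hα)
  refine ⟨EllipticDunkl.functionalEquations_ellFun hR hℓ hτ hk' hlam,
    fun U hU hreg hS => ⟨fun g hg ξ η x hx => ?_, fun g _ w hw ξ x _ => ?_⟩,
    fun U hU hreg hS g hg => ⟨fun ξ η x hx => ?_, fun w hw ξ x _ => ?_⟩⟩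
  · exact EllipticDunkl.ellDunkl_comm hR hℓ hτ hk' hlam hU hreg
      (fun α hα => hS _ (EllipticDunkl.refl_mem_weylGroup hα)) hg ξ η hx
  · exact EllipticDunkl.ellDunkl_equivariant hR hℓ hk hw g ξ x
  · exact EllipticDunkl.ellDunklC_comm hR hℓ hτ hk' hlam hU hreg
      (fun α hα => hS _ (EllipticDunkl.refl_mem_weylGroup hα)) hg ξ η hx
  · exact EllipticDunkl.ellDunklC_equivariant hR hℓ hk hw g ξ x
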